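/- **Setting.** Let $x=(x_1,\dots,x_K)$ with $x_k\in\mathbb R^{n_k}$, $x\in\mathbb R^n$, and consider $$\min\ f(x)=g(x)+\sum_{k=1}^K h_k(x_k)\quad\text{s.t.}\quad Ex=\sum_{k=1}^K E_kx_k=q,\quad x\in X=\prod_{k=1}^K X_k, \qquad(\mathrm P)$$ with $q\in\mathbb R^m$. Write $h(x)=\sum_k h_k(x_k)$. For a constant $\rho>0$ let $$L(x;y)=f(x)+\langle y,q-Ex\rangle+\tfrac\rho2\|q-Ex\|^2,\qquad d(y)=\min_{x\in X}L(x;y),\qquad X(y)=\arg\min_{x\in X}L(x;y),$$ $$\varphi(x)=g(x)+\tfrac\rho2\|Ex-q\|^2 .$$ A point $x$ is primal optimal if it solves $(\mathrm P)$, and $y$ is dual optimal if it maximizes $d$ over $\mathbb R^m$. **Assumption A.** (a) $f$ is a closed proper convex function (with values in $\mathbb R\cup\{+\infty\}$), $g$ is convex, and continuously differentiable on $\operatorname{int}(\operatorname{dom} g)$; $(\mathrm P)$ has a solution, $d$ attains its maximum, and $X\cap\operatorname{int}(\operatorname{dom} f)\cap\{x: Ex=q\}\neq\emptyset$. (b)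 $g(x)=\ell(Ax)+\langle x,b\rangle$ for a matrix $A$, a vector $b$ and a function $\ell$ that is strictly convex and continuously differentiable on $\operatorname{int}(\operatorname{dom}\ell)$; and $h_k(x_k)=\lambda_k\|x_k\|_1+\sum_J w_J\|x_{k,J}\|_2$, where $x_k=(\dots,x_{k,J},\dots)$ is a partition of the coordinates of $x_k$ and $\lambda_k,w_J\ge0$. (c) Each $X_k=\{x_k: C_kx_k\le c_k\}$ is a compact polyhedral set. **Assumption B.** The set $X$ is contained in $\operatorname{int}(\operatorname{dom} g)$, and for each $k$ the function $u_k(v_k;x)$, differentiable in $v_k$ at every $v_k\in X_k$ for every $x\in X$, satisfies, for all $x\in X$ and $v_k,\hat v_k\in X_k$ (gradients of $u_k$ are taken in the first argument): (a) $u_k(x_k;x)=\varphi(x)$; (b) $u_k(v_k;x)\ge\varphi(v_k,x_{-k})$, where $(v_k,x_{-k})$ is $x$ with $k$-th block replaced by $v_k$; (c) $\nabla u_k(x_k;x)=\nabla_k\varphi(x)$; (d) $u_k$ is continuous on $X_k\times X$, and $u_k(v_k;x)\ge u_k(\hat v_k;x)+\langle\nabla u_k(\hat v_k;x),v_k-\hat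 v_k\rangle+\frac{\gamma_k}2\|v_k-\hat v_k\|^2$ with $\gamma_k>0$ independent of $x,v_k,\hat v_k$; (e) $\|\nabla u_k(v_k;x)-\nabla u_k(\hat v_k;x)\|\le L_k\|v_k-\hat v_k\|$ with $L_k>0$ independent of $x,v_k,\hat v_k$. **Error bound.** With $\operatorname{prox}(v)=\arg\min_{z\in X}\,h(z)+\frac12\|v-z\|^2$ and $\tilde\nabla_xL(x;y)=x-\operatorname{prox}\big(x-\nabla_x(L(x;y)-h(x))\big)$, there are constants $\tau,\delta>0$, independent of $x$ and $y$, such that $\operatorname{dist}(x,X(y))\le\tau\|\tilde\nabla_xL(x;y)\|$ for all $y\in\mathbb R^m$ and all $x\in X$ with $\|\tilde\nabla_xL(x;y)\|\le\delta$. (As $X$ is bounded, this is equivalent, up to the value of $\tau$, to the bound for all $x\in X$ and all $y$.) **Algorithms.** Let $\alpha^r>0$ be dual stepsizes, and let the starting point satisfy $x^1\in X$, $y^1\in\mathbb R^m$. *BSUM-M:* for $r\ge1$, $y^{r+1}=y^r+\alpha^r(q-Ex^r)$ and then, for $k=1,\dots,K$ in this order, $$x_k^{r+1}=\arg\min_{x_k\in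 X_k}u_k(x_k;w_k^{r+1})-\langle y^{r+1},E_kx_k\rangle+h_k(x_k),\qquad w_k^{r+1}=(x_1^{r+1},\dots,x_{k-1}^{r+1},x_k^r,\dots,x_K^r).$$ *RBSUM-M:* fix probabilities $p_0,\dots,p_K>0$ with $\sum_{k=0}^Kp_k=1$, and a deterministic starting point $(x^1,y^1)$. At each iteration $t\ge1$ draw an index $k\in\{0,\dots,K\}$ with probability $p_k$, independently of the other draws. If $k=0$, set $y^{t+1}=y^t+\alpha^t(q-Ex^t)$ and $x^{t+1}=x^t$. If $k\ge1$, set $x_k^{t+1}=\arg\min_{x_k\in X_k}u_k(x_k;x^t)-\langle y^t,E_kx_k\rangle+h_k(x_k)$, $x_j^{t+1}=x_j^t$ for $j\ne k$, and $y^{t+1}=y^t$. **Theorem 2.1.** Suppose that Assumption A, Assumption B and the error bound hold. Then there is a constant $\bar\alpha>0$ (for RBSUM-M it may also depend on $p_0,\dots,p_K$), independent of the starting point and of the iterates, such that the following holds whenever either i) $\alpha^r=\alpha$ for all $r$ with a constant $0<\alpha<\bar\alpha$, or ii) $\alpha^r>0$, $\sum_{r=1}^\infty\alpha^r=\infty$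 and $\lim_{r\to\infty}\alpha^r=0$. 1. For BSUM-M, every $X(y^r)$ has a point $\bar x^r$ nearest to $x^r$, and $\lim_{r\to\infty}\|Ex^r-q\|=0$, $\lim_{r\to\infty}\|x^r-x^{r+1}\|=0$ and $\lim_{r\to\infty}\|x^r-\bar x^r\|=0$. Further, for every limit point $(x^\infty,y^\infty)$ of $\{(x^r,y^r)\}$, $x^\infty$ is primal optimal and $y^\infty$ is dual optimal. 2. For RBSUM-M, the same conclusions hold with probability 1. -/

import Mathlib

open Filter Topology MeasureTheory ProbabilityTheory

/-- The space of the `k`-th block variable, with its Euclidean norm. -/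
abbrev Blk {K : ℕ} (n : Fin K → ℕ) (k : Fin K) : Type := EuclideanSpace ℝ (Fin (n k))

/-- The space of the full variable `x = (x_1, …, x_K)`, with its Euclidean norm. -/
abbrev FullVar {K : ℕ} (n : Fin K → ℕ) : Type := PiLp 2 (fun k : Fin K => Blk n k)

/-- `(v, x_{-k})`: the vector `x` with its `k`-th block replaced by `v`. -/
noncomputable def replaceBlock {K : ℕ} {n : Fin K → ℕ} (x : FullVar n) (k : Fin K) (v : Blk n k) :
    FullVar n :=
  WithLp.toLp 2 (Function.update (fun j => x j) k v)

/-- `w_k = (x'_1, …, x'_{k-1}, x_k, …, x_K)`: blocks before `k` are new, the others are old. -/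
noncomputable def mixBlocks {K : ℕ} {n : Fin K → ℕ} (x' x : FullVar n) (k : Fin K) : FullVar n :=
  WithLp.toLp 2 (fun j => if j < k then x' j else x j)

/-- The data of the problem: minimize `g(x) + ∑ k, h_k(x_k)` subject to `∑ k, E_k x_k = q` and
`x_k ∈ X_k`, where `g(x) = ℓ(Ax) + ⟨x, b⟩`, `h_k` is a weighted sum of the `ℓ₁` norm and of the
Euclidean norms of a partition of the coordinates, and `X_k = {x_k | C_k x_k ≤ c_k}`.

The extended-valued function `ℓ` is given by its effective domain `domEll` and by its (real) values
`ell` on it; the values of `ell` outside `domEll` are irrelevant. The partition of the coordinates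
of the `k`-th block is given by the map `grp k` that sends a coordinate to the label of its class
(at most `n k` labels are needed). -/
structure BlockProblem (K m p : ℕ) (n s : Fin K → ℕ) where
  E : (k : Fin K) → Blk n k →L[ℝ] EuclideanSpace ℝ (Fin m)
  q : EuclideanSpace ℝ (Fin m)
  A : FullVar n →L[ℝ] EuclideanSpace ℝ (Fin p)
  b : FullVar n
  domEll : Set (EuclideanSpace ℝ (Fin p))
  ell : EuclideanSpace ℝ (Fin p) → ℝ
  lam : Fin K → ℝ
  grp : (k : Fin K) → Fin (n k) → Fin (n k)
  wt : (k : Fin K) → Fin (n k) → ℝ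
  C : (k : Fin K) → Matrix (Fin (s k)) (Fin (n k)) ℝ
  c : (k : Fin K) → Fin (s k) → ℝ
  rho : ℝ

namespace BlockProblem

variable {K m p : ℕ} {n s : Fin K → ℕ} (P : BlockProblem K m p n s)

/-- The effective domain of `g` (and of `f`, since every `h_k` is finite everywhere). -/
def dom : Set (FullVar n) := {x | P.A x ∈ P.domEll}

noncomputable def g (x : FullVar n) : ℝ := P.ell (P.A x) + inner ℝ x P.b

noncomputable def hBlk (k : Fin K) (v : Blk n k) : ℝ :=
  P.lam k * (∑ i, |v i|) +
    ∑ J, P.wt k J * Real.sqrt (∑ i, if P.grp k i = J then (v i) ^ 2 else 0)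

noncomputable def h (x : FullVar n) : ℝ := ∑ k, P.hBlk k (x k)

noncomputable def f (x : FullVar n) : ℝ := P.g x + P.h x

/-- `Ex = E_1 x_1 + ⋯ + E_K x_K`. -/
noncomputable def Emap (x : FullVar n) : EuclideanSpace ℝ (Fin m) := ∑ k, P.E k (x k)

def XBlk (k : Fin K) : Set (Blk n k) := {v | ∀ i, ∑ j, P.C k i j * v j ≤ P.c k i}

def X : Set (FullVar n) := {x | ∀ k, x k ∈ P.XBlk k}

/-- The smooth part `g(x) + ⟨y, q - Ex⟩ + (ρ/2) ‖q - Ex‖²` of the augmented Lagrangian. -/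
noncomputable def smoothL (x : FullVar n) (y : EuclideanSpace ℝ (Fin m)) : ℝ :=
  P.g x + inner ℝ y (P.q - P.Emap x) + P.rho / 2 * ‖P.q - P.Emap x‖ ^ 2

/-- The augmented Lagrangian `f(x) + ⟨y, q - Ex⟩ + (ρ/2) ‖q - Ex‖²`. -/
noncomputable def L (x : FullVar n) (y : EuclideanSpace ℝ (Fin m)) : ℝ :=
  P.f x + inner ℝ y (P.q - P.Emap x) + P.rho / 2 * ‖P.q - P.Emap x‖ ^ 2

/-- The augmented dual function `d(y) = min_{x ∈ X} L(x; y)`. -/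
noncomputable def dualFun (y : EuclideanSpace ℝ (Fin m)) : ℝ := sInf ((fun x => P.L x y) '' P.X)

/-- `X(y)`, the set of minimizers of `L(·; y)` over `X`. -/
def argminL (y : EuclideanSpace ℝ (Fin m)) : Set (FullVar n) :=
  {x | x ∈ P.X ∧ ∀ z ∈ P.X, P.L x y ≤ P.L z y}

def IsPrimalOptimal (x : FullVar n) : Prop :=
  (x ∈ P.X ∧ P.Emap x = P.q) ∧ ∀ z ∈ P.X, P.Emap z = P.q → P.f x ≤ P.f z

def IsDualOptimal (y : EuclideanSpace ℝ (Fin m)) : Prop := ∀ y', P.dualFun y' ≤ P.dualFun y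

/-- The standing assumptions on the problem. A closed proper convex `f` is described by its
effective domain `P.dom` and its real values there: it is closed if its epigraph is closed, and
proper if `P.dom` is nonempty (which is part of `slater`). -/
structure AssumptionA : Prop where
  rho_pos : 0 < P.rho
  convex_g : ConvexOn ℝ P.dom P.g
  closed_f : IsClosed {z : FullVar n × ℝ | z.1 ∈ P.dom ∧ P.f z.1 ≤ z.2}
  smooth_g : ContDiffOn ℝ 1 P.g (interior P.dom)
  primal_attained : ∃ x, P.IsPrimalOptimal x
  dual_attained : ∃ y, P.IsDualOptimal y
  slater : (P.X ∩ interior P.dom ∩ {x | P.Emap x = P.q}).Nonempty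
  ell_strictConvex : StrictConvexOn ℝ (interior P.domEll) P.ell
  ell_contDiff : ContDiffOn ℝ 1 P.ell (interior P.domEll)
  lam_nonneg : ∀ k, 0 ≤ P.lam k
  wt_nonneg : ∀ k J, 0 ≤ P.wt k J
  compact_X : ∀ k, IsCompact (P.XBlk k)

/-- The smooth function `φ(x) = g(x) + (ρ/2) ‖Ex - q‖²` that the functions `u_k` approximate. -/
noncomputable def phi (x : FullVar n) : ℝ := P.g x + P.rho / 2 * ‖P.Emap x - P.q‖ ^ 2

/-- The assumptions on the approximation functions `u_k(v_k; x)`, written `u k v x`. The values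
and the gradients in `tight` and `grad_eq` exist at every `x ∈ X` only if the extended-valued
function `g` is finite near every point of `X`; this is the first field. -/
structure AssumptionB (u : (k : Fin K) → Blk n k → FullVar n → ℝ) : Prop where
  X_subset : P.X ⊆ interior P.dom
  tight : ∀ k, ∀ x ∈ P.X, u k (x k) x = P.phi x
  upper : ∀ k, ∀ x ∈ P.X, ∀ v ∈ P.XBlk k, P.phi (replaceBlock x k v) ≤ u k v x
  diff : ∀ k, ∀ x ∈ P.X, ∀ v ∈ P.XBlk k, DifferentiableAt ℝ (fun v' => u k v' x) v
  grad_eq : ∀ k, ∀ x ∈ P.X, gradient (fun v' => u k v' x) (x k) = (gradient P.phi x) k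
  cont : ∀ k, ContinuousOn (fun z : Blk n k × FullVar n => u k z.1 z.2) (P.XBlk k ×ˢ P.X)
  strong : ∀ k, ∃ γ : ℝ, 0 < γ ∧ ∀ x ∈ P.X, ∀ v ∈ P.XBlk k, ∀ v' ∈ P.XBlk k,
    u k v' x + inner ℝ (gradient (fun z => u k z x) v') (v - v') + γ / 2 * ‖v - v'‖ ^ 2 ≤ u k v x
  lip : ∀ k, ∃ Lk : ℝ, 0 < Lk ∧ ∀ x ∈ P.X, ∀ v ∈ P.XBlk k, ∀ v' ∈ P.XBlk k,
    ‖gradient (fun z => u k z x) v - gradient (fun z => u k z x) v'‖ ≤ Lk * ‖v - v'‖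

/-- `z` is the point `argmin_{z ∈ X} h(z) + (1/2) ‖v - z‖²`. -/
def IsProx (v z : FullVar n) : Prop :=
  z ∈ P.X ∧ ∀ z' ∈ P.X, P.h z + 1 / 2 * ‖v - z‖ ^ 2 ≤ P.h z' + 1 / 2 * ‖v - z'‖ ^ 2

/-- `w = x - prox_h (x - ∇_x (L(x; y) - h(x)))`, the proximal gradient of `L(·; y)` at `x`. The
prox, with the constraint `x ∈ X`, exists and is unique, so this determines `w`. -/
def IsProxGradient (x : FullVar n) (y : EuclideanSpace ℝ (Fin m)) (w : FullVar n) : Prop :=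
  P.IsProx (x - gradient (fun z => P.smoothL z y) x) (x - w)

/-- The error bound: `dist(x, X(y)) ≤ τ ‖∇̃_x L(x; y)‖` for all `y` and all `x ∈ X` whose proximal
gradient has norm at most `δ`, with constants that depend neither on `x` nor on `y`. For bounded
`X` this is the same as the bound for all `x ∈ X` (with another `τ`). -/
def ErrorBound : Prop :=
  ∃ τ δ : ℝ, 0 < τ ∧ 0 < δ ∧ ∀ (y : EuclideanSpace ℝ (Fin m)), ∀ x ∈ P.X, ∀ w : FullVar n,
    P.IsProxGradient x y w → ‖w‖ ≤ δ → Metric.infDist x (P.argminL y) ≤ τ * ‖w‖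

/-- `v = argmin_{v ∈ X_k} u_k(v; x) - ⟨y, E_k v⟩ + h_k(v)`. -/
def IsBlockArgmin (u : (k : Fin K) → Blk n k → FullVar n → ℝ) (k : Fin K) (x : FullVar n)
    (y : EuclideanSpace ℝ (Fin m)) (v : Blk n k) : Prop :=
  v ∈ P.XBlk k ∧ ∀ v' ∈ P.XBlk k,
    u k v x - inner ℝ y (P.E k v) + P.hBlk k v ≤ u k v' x - inner ℝ y (P.E k v') + P.hBlk k v'

/-- `(x, y)` is a sequence of iterates of BSUM-M with dual stepsizes `α`, started in `X`. -/
def IsBSUMM (u : (k : Fin K) → Blk n k → FullVar n → ℝ) (α : ℕ → ℝ)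
    (x : ℕ → FullVar n) (y : ℕ → EuclideanSpace ℝ (Fin m)) : Prop :=
  x 0 ∈ P.X ∧ ∀ r : ℕ,
    y (r + 1) = y r + α r • (P.q - P.Emap (x r)) ∧
    ∀ k, P.IsBlockArgmin u k (mixBlocks (x (r + 1)) (x r) k) (y (r + 1)) (x (r + 1) k)

/-- `(x, y)` is a sequence of iterates of RBSUM-M with dual stepsizes `α`, started in `X`, when the
index picked at iteration `t` is `i t`: the index `0` stands for the dual variable and the index
`k.succ` for the `k`-th block. -/
def IsRBSUMM (u : (k : Fin K) → Blk n k → FullVar n → ℝ) (α : ℕ → ℝ) (i : ℕ → Fin (K + 1))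
    (x : ℕ → FullVar n) (y : ℕ → EuclideanSpace ℝ (Fin m)) : Prop :=
  x 0 ∈ P.X ∧ ∀ t : ℕ,
    (i t = 0 → y (t + 1) = y t + α t • (P.q - P.Emap (x t)) ∧ x (t + 1) = x t) ∧
    ∀ k : Fin K, i t = k.succ →
      P.IsBlockArgmin u k (x t) (y t) (x (t + 1) k) ∧
      (∀ j, j ≠ k → x (t + 1) j = x t j) ∧ y (t + 1) = y t

/-- `z` is the point of `X(y)` nearest to `x`. -/
def IsNearest (x : FullVar n) (y : EuclideanSpace ℝ (Fin m)) (z : FullVar n) : Prop :=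
  z ∈ P.argminL y ∧ ∀ z' ∈ P.argminL y, ‖z - x‖ ≤ ‖z' - x‖

/-- The asserted convergence of a sequence of iterates. -/
def Converges (x : ℕ → FullVar n) (y : ℕ → EuclideanSpace ℝ (Fin m)) : Prop :=
  Tendsto (fun r => ‖P.Emap (x r) - P.q‖) atTop (𝓝 0) ∧
  Tendsto (fun r => ‖x r - x (r + 1)‖) atTop (𝓝 0) ∧
  (∃ xbar : ℕ → FullVar n, (∀ r, P.IsNearest (x r) (y r) (xbar r)) ∧
    Tendsto (fun r => ‖x r - xbar r‖) atTop (𝓝 0)) ∧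
  ∀ (a : FullVar n) (b : EuclideanSpace ℝ (Fin m)),
    MapClusterPt (a, b) atTop (fun r => (x r, y r)) → P.IsPrimalOptimal a ∧ P.IsDualOptimal b

end BlockProblem

/-- Positive stepsizes that are either constant and smaller than `abar`, or tend to `0` and have a
divergent sum. -/
def StepsizeRule (abar : ℝ) (α : ℕ → ℝ) : Prop :=
  (∀ r, 0 < α r) ∧
  ((∃ a, a < abar ∧ ∀ r, α r = a) ∨
    (Tendsto (fun N => ∑ r ∈ Finset.range N, α r) atTop atTop ∧ Tendsto α atTop (𝓝 0)))

/-! The proof follows the potential `L(x;y) - 2 d(y)`, the sum of `L(x;y) - d(y) ≥ 0` and `-d(y)`,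
which is bounded below by minus the primal optimal value.

Because of the term `(ρ/2)‖q - Ex‖²`, the value `E x̄` is the same for all `x̄ ∈ X(y)`, so that
`N(y) = ‖q - E x̄‖` is well defined; it is Lipschitz in `y` with constant `2/ρ` (`norm_Emap_sub_le`,
`exists_dualResidual`). A dual step of length `α` changes the potential by at most `α‖Ex - E x̄‖² -
α N²`, with `x̄` a minimizer at the new multiplier (`potential_dual_step_le_of_mem`). Block updates
lower it by `γ/2` times the squared length of the move (`L_cycle_le`). The error bound gives `‖Ex -
E x̄‖ ≤ const · (length of the move)` (`exists_infDist_argminL_le`). For small `α` the bad term is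
absorbed, and both the squared moves and `α N²` are summable. Hence the moves and the distances to
`X(y)` tend to `0`. Also `N → 0`: for constant steps at once, for diminishing steps because `N`
changes by `O(α)` per iteration while `∑ α = ∞` (`tendsto_zero_of_summable_mul_min_sq`). Optimality
of limit points follows by continuity (`converges_of_tendsto`).

Using the error bound requires a Lipschitz gradient of `φ`, although `g` is only `C¹`. The
surrogates supply it: they give quadratic upper bounds in each block, Jensen's inequality combines
these into a joint bound, and a convex function with quadratic upper bounds has a Lipschitz gradient
(`ConvexOn.inner_gradient_sub_le`). As `X` may have empty interior, only directions of its affine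
span are tested.

In the random algorithm the move is replaced by the hypothetical one that updates all blocks from
the same point, and the potential decreases in conditional expectation. Iterates depend on finitely
many draws from a finite set, so expectations are elementary, and summable expectations give almost
sure summability (`ae_summable_of_sum_mul_le`). -/

section Generic

/-! ### First-order inequalities for convex functions, and summability of real sequences. -/

variable {F : Type*} [NormedAddCommGroup F] [InnerProductSpace ℝ F] [CompleteSpace F]

theorem inner_gradient_le_of_forall_le {f : F → ℝ} {x d : F} {c : ℝ} (hf : DifferentiableAt ℝ f x)
    (h : ∀ t ∈ Set.Ioc (0 : ℝ) 1, f (x + t • d) ≤ f x + t * c) :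
    inner ℝ (gradient f x) d ≤ c := by
  have h1 : HasDerivAt (fun t : ℝ => f (x + t • d)) (inner ℝ (gradient f x) d) 0 := by
    have := hf.hasGradientAt.hasFDerivAt.hasLineDerivAt d
    simpa [HasLineDerivAt] using this
  have h2 := h1.tendsto_slope_zero_right
  refine le_of_tendsto h2 ?_
  filter_upwards [Ioc_mem_nhdsGT (zero_lt_one' ℝ)] with t ht
  have := h t ht
  have h0 : t⁻¹ * t = 1 := inv_mul_cancel₀ ht.1.ne'
  have h3 : 0 < t⁻¹ := inv_pos.2 ht.1
  simp only [zero_add, zero_smul, add_zero, smul_eq_mul]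
  calc t⁻¹ * (f (x + t • d) - f x) ≤ t⁻¹ * (t * c) := by gcongr; linarith
    _ = c := by rw [← mul_assoc, h0, one_mul]

theorem le_inner_gradient_of_forall_le {f : F → ℝ} {x d : F} {c : ℝ} (hf : DifferentiableAt ℝ f x)
    (h : ∀ t ∈ Set.Ioc (0 : ℝ) 1, f x + t * c ≤ f (x + t • d)) :
    c ≤ inner ℝ (gradient f x) d := by
  have h1 : HasDerivAt (fun t : ℝ => f (x + t • d)) (inner ℝ (gradient f x) d) 0 := by
    have := hf.hasGradientAt.hasFDerivAt.hasLineDerivAt d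
    simpa [HasLineDerivAt] using this
  have h2 := h1.tendsto_slope_zero_right
  refine ge_of_tendsto h2 ?_
  filter_upwards [Ioc_mem_nhdsGT (zero_lt_one' ℝ)] with t ht
  have := h t ht
  have h0 : t⁻¹ * t = 1 := inv_mul_cancel₀ ht.1.ne'
  have h3 : 0 < t⁻¹ := inv_pos.2 ht.1
  simp only [zero_add, zero_smul, add_zero, smul_eq_mul]
  calc c = t⁻¹ * (t * c) := by rw [← mul_assoc, h0, one_mul]
    _ ≤ t⁻¹ * (f (x + t • d) - f x) := by gcongr; linarith

/-- The first-order inequality for convex functions. -/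
theorem ConvexOn.add_inner_gradient_le {S : Set F} {f : F → ℝ} (hf : ConvexOn ℝ S f) {x z : F}
    (hx : x ∈ S) (hz : z ∈ S) (hd : DifferentiableAt ℝ f x) :
    f x + inner ℝ (gradient f x) (z - x) ≤ f z := by
  have := inner_gradient_le_of_forall_le (d := z - x) (c := f z - f x) hd (fun t ht => by
    have h := hf.2 hx hz (sub_nonneg.2 ht.2) ht.1.le (by ring)
    have e : x + t • (z - x) = (1 - t) • x + t • z := by module
    rw [e]
    simp only [smul_eq_mul] at h
    linarith)
  linarith

/-- The variational inequality satisfied by a minimizer of the sum of a differentiable function and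
a convex function. -/
theorem ConvexOn.sub_le_inner_gradient_of_isMin {S : Set F} {f H : F → ℝ} (hH : ConvexOn ℝ S H)
    {p z : F} (hp : p ∈ S) (hz : z ∈ S) (hd : DifferentiableAt ℝ f p)
    (hmin : ∀ w ∈ S, f p + H p ≤ f w + H w) :
    H p - H z ≤ inner ℝ (gradient f p) (z - p) := by
  refine le_inner_gradient_of_forall_le hd (fun t ht => ?_)
  have h := hH.2 hp hz (sub_nonneg.2 ht.2) ht.1.le (by ring)
  have hw := hmin _ (hH.1 hp hz (sub_nonneg.2 ht.2) ht.1.le (by ring))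
  have e : p + t • (z - p) = (1 - t) • p + t • z := by module
  rw [e]
  simp only [smul_eq_mul] at h
  linarith

/-- Divergence of `∑ α` forces `b` to be small infinitely often, and the bound on its increments
prevents it from oscillating. The minimum of two consecutive terms lets the same lemma serve whether
the weight `α r` goes with `b r` or with `b (r + 1)`. -/
theorem tendsto_zero_of_summable_mul_min_sq {α b : ℕ → ℝ} {C : ℝ} (hα : ∀ r, 0 < α r)
    (hb : ∀ r, 0 ≤ b r) (hC : ∀ r, |b (r + 1) - b r| ≤ C * α r)
    (hs : Summable (fun r => α r * (min (b r) (b (r + 1))) ^ 2))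
    (hdiv : Tendsto (fun N => ∑ r ∈ Finset.range N, α r) atTop atTop)
    (hlim : Tendsto α atTop (𝓝 0)) : Tendsto b atTop (𝓝 0) := by
  have hC0 : 0 ≤ C := by
    by_contra hneg
    have h1 := hC 0
    have h2 := abs_nonneg (b (0 + 1) - b 0)
    nlinarith [hα 0]
  have key : ∀ ε > 0, ∀ᶠ r in atTop, b r < 2 * ε := by
    intro ε hε
    -- The part of `b` above `ε` has summable variation: it moves only where `b` is at least `ε /
    -- 2`, and there `α r` is controlled by the summable terms.
    set c : ℕ → ℝ := fun r => max (b r - ε) 0 with hc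
    have hsmall : ∀ᶠ r in atTop, C * α r < ε / 2 := by
      have : Tendsto (fun r => C * α r) atTop (𝓝 (C * 0)) := hlim.const_mul C
      rw [mul_zero] at this
      exact this.eventually_lt_const (by positivity)
    obtain ⟨T, hT⟩ := eventually_atTop.1 hsmall
    have hstep : ∀ r, T ≤ r →
        dist (c r) (c (r + 1)) ≤ C * (4 / ε ^ 2) * (α r * (min (b r) (b (r + 1))) ^ 2) := by
      intro r hr
      have h1 := hC r
      have h2 := hT r hr
      have habs := abs_le.1 h1
      by_cases hcase : b r ≤ ε ∧ b (r + 1) ≤ ε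
      · have e1 : c r = 0 := max_eq_right (by linarith)
        have e2 : c (r + 1) = 0 := max_eq_right (by linarith)
        rw [e1, e2, dist_self]
        have := hα r
        positivity
      -- One of the two terms exceeds `ε`, and they differ by less than `ε / 2`.
      · have hm : ε / 2 ≤ min (b r) (b (r + 1)) := by
          rw [not_and_or] at hcase
          rcases hcase with h | h <;> push Not at h <;> exact le_min (by linarith) (by linarith)
        have hd : dist (c r) (c (r + 1)) ≤ C * α r := by
          rw [Real.dist_eq]
          refine (abs_max_sub_max_le_abs _ _ _).trans ?_
          rw [abs_sub_comm, sub_sub_sub_cancel_right]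
          exact h1
        have hm2 : (ε / 2) ^ 2 ≤ (min (b r) (b (r + 1))) ^ 2 := by gcongr
        have hm3 : 1 ≤ 4 / ε ^ 2 * (min (b r) (b (r + 1))) ^ 2 := by
          calc (1 : ℝ) = 4 / ε ^ 2 * (ε / 2) ^ 2 := by field_simp; norm_num
            _ ≤ _ := by gcongr
        calc dist (c r) (c (r + 1)) ≤ C * α r * 1 := by simpa using hd
          _ ≤ C * α r * (4 / ε ^ 2 * (min (b r) (b (r + 1))) ^ 2) := by
            have := hα r
            gcongr
          _ = _ := by ring
    have hsum : Summable (fun r => dist (c (r + T)) (c (r + T + 1))) := by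
      refine Summable.of_nonneg_of_le (fun _ => dist_nonneg)
        (fun r => hstep (r + T) (Nat.le_add_left _ _)) ?_
      exact ((summable_nat_add_iff T).2 hs).mul_left _
    have hcau : CauchySeq (fun r => c (r + T)) := by
      refine cauchySeq_of_summable_dist ?_
      refine hsum.congr (fun r => ?_)
      rw [Nat.succ_eq_add_one, add_right_comm]
    obtain ⟨l, hl⟩ := cauchySeq_tendsto_of_complete hcau
    have hl' : Tendsto c atTop (𝓝 l) := (tendsto_add_atTop_iff_nat T).1 hl
    -- A positive limit would keep `b ≥ ε` eventually and make `∑ α` finite.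
    have hl0 : l ≤ 0 := by
      by_contra hpos
      push Not at hpos
      have hev : ∀ᶠ r in atTop, 0 < c r := hl'.eventually_const_lt hpos
      obtain ⟨T', hT'⟩ := eventually_atTop.1 hev
      have hbig : ∀ r, T' ≤ r → ε ≤ b r := by
        intro r hr
        by_contra hh
        push Not at hh
        have := hT' r hr
        rw [hc] at this
        simp only [lt_max_iff, lt_self_iff_false, or_false] at this
        linarith
      have hsα : Summable (fun r => α (r + T')) := by
        refine Summable.of_nonneg_of_le (fun r => (hα _).le) (fun r => ?_)
          (((summable_nat_add_iff T').2 hs).mul_left (1 / ε ^ 2))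
        have h1 : ε ≤ min (b (r + T')) (b (r + T' + 1)) :=
          le_min (hbig _ (by omega)) (hbig _ (by omega))
        have h2 : ε ^ 2 ≤ (min (b (r + T')) (b (r + T' + 1))) ^ 2 := by gcongr
        calc α (r + T') = 1 / ε ^ 2 * (α (r + T') * ε ^ 2) := by field_simp
          _ ≤ _ := by
            have := hα (r + T')
            gcongr
      have hsα' : Summable α := (summable_nat_add_iff T').1 hsα
      exact not_tendsto_nhds_of_tendsto_atTop hdiv _ hsα'.hasSum.tendsto_sum_nat
    filter_upwards [hl'.eventually_lt_const (lt_of_le_of_lt hl0 hε)] with r hr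
    have : b r - ε ≤ c r := le_max_left _ _
    linarith
  rw [Metric.tendsto_atTop]
  intro ε hε
  obtain ⟨N, hN⟩ := eventually_atTop.1 (key (ε / 2) (by positivity))
  refine ⟨N, fun r hr => ?_⟩
  rw [Real.dist_eq, sub_zero, abs_of_nonneg (hb r)]
  linarith [hN r hr]

/-- A real sequence that is bounded below and decreases by at least `D r` is such that `D` is
summable. -/
theorem summable_of_le_sub {V D : ℕ → ℝ} {B : ℝ} (hD : ∀ r, 0 ≤ D r) (hV : ∀ r, B ≤ V r)
    (h : ∀ r, V (r + 1) ≤ V r - D r) : Summable D := by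
  refine summable_of_sum_range_le (c := V 0 - B) hD (fun N => ?_)
  have : ∑ r ∈ Finset.range N, D r ≤ V 0 - V N := by
    induction N with
    | zero => simp
    | succ N ih =>
      rw [Finset.sum_range_succ]
      linarith [h N]
  linarith [hV N]

end Generic

/-! ### Lipschitz gradients from quadratic upper bounds, relative to the affine span. -/

section Generic

variable {F : Type*} [NormedAddCommGroup F] [InnerProductSpace ℝ F]

/-- A convex set in a finite-dimensional space contains a ball of its affine span. -/
theorem Convex.exists_forall_vectorSpan_add_mem [FiniteDimensional ℝ F] {S : Set F}
    (hS : Convex ℝ S) (hne : S.Nonempty) :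
    ∃ x₀ ∈ S, ∃ ε > 0, ∀ d ∈ vectorSpan ℝ S, ‖d‖ ≤ ε → x₀ + d ∈ S := by
  obtain ⟨x₀, hx₀⟩ := hne.intrinsicInterior hS
  obtain ⟨y, hy, rfl⟩ := mem_intrinsicInterior.1 hx₀
  obtain ⟨ε, hε, hball⟩ := Metric.isOpen_iff.1 isOpen_interior y hy
  refine ⟨y, Set.mem_preimage.1 (interior_subset hy), ε / 2, by positivity, fun d hd hdn => ?_⟩
  have hd' : d ∈ (affineSpan ℝ S).direction := by rwa [direction_affineSpan]
  have hm : d +ᵥ (y : F) ∈ affineSpan ℝ S :=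
    AffineSubspace.vadd_mem_of_mem_direction hd' y.2
  have : (⟨d +ᵥ (y : F), hm⟩ : affineSpan ℝ S) ∈ Metric.ball y ε := by
    rw [Metric.mem_ball, Subtype.dist_eq]
    simp only [vadd_eq_add, dist_add_self_left]
    linarith
  have h2 := interior_subset (hball this)
  simpa [add_comm] using h2

variable [CompleteSpace F]

/-- Rescale `d` to a vector `δ` of length `‖u - v‖`. Going from `u` to `v` and then to `v + δ` by
two quadratic upper bounds, and comparing with the tangent at `u`, leaves an error `M ‖u - v‖²`. -/
theorem ConvexOn.inner_gradient_sub_le_of_near {S : Set F} {φ : F → ℝ} {M ε : ℝ}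
    (hφ : ConvexOn ℝ S φ) (hd : ∀ x ∈ S, DifferentiableAt ℝ φ x) {u v d : F}
    (hu : u ∈ S) (hv : v ∈ S) (hdm : d ∈ vectorSpan ℝ S)
    (hball : ∀ d ∈ vectorSpan ℝ S, ‖d‖ ≤ ε → v + d ∈ S)
    (hqu : ∀ d ∈ vectorSpan ℝ S, ‖d‖ ≤ ε →
      φ (u + d) ≤ φ u + inner ℝ (gradient φ u) d + M / 2 * ‖d‖ ^ 2)
    (hqv : ∀ d ∈ vectorSpan ℝ S, ‖d‖ ≤ ε →
      φ (v + d) ≤ φ v + inner ℝ (gradient φ v) d + M / 2 * ‖d‖ ^ 2)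
    (huv : ‖u - v‖ ≤ ε) :
    inner ℝ (gradient φ u - gradient φ v) d ≤ M * ‖u - v‖ * ‖d‖ := by
  rcases eq_or_ne u v with rfl | hne
  · simp
  rcases eq_or_ne d 0 with rfl | hd0
  · simp
  have ht : 0 < ‖u - v‖ := norm_pos_iff.2 (sub_ne_zero.2 hne)
  have hdn : 0 < ‖d‖ := norm_pos_iff.2 hd0
  set t := ‖u - v‖ with htdef
  set s : ℝ := t / ‖d‖ with hs
  have hspos : 0 < s := by positivity
  have hδm : s • d ∈ vectorSpan ℝ S := Submodule.smul_mem _ _ hdm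
  have hδn : ‖s • d‖ = t := by
    rw [norm_smul, Real.norm_of_nonneg hspos.le, hs]
    field_simp
  have h1 := hqv _ hδm (hδn.le.trans huv)
  have hvu : v - u ∈ vectorSpan ℝ S := vsub_mem_vectorSpan ℝ hv hu
  have hvun : ‖v - u‖ = t := norm_sub_rev _ _
  have h2 := hqu _ hvu (hvun.le.trans huv)
  have h3 := hφ.add_inner_gradient_le hu (hball _ hδm (hδn.le.trans huv)) (hd u hu)
  rw [add_sub_cancel, hvun] at h2
  have e : v + s • d - u = (v - u) + s • d := by abel
  rw [e, inner_add_right] at h3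
  rw [hδn] at h1
  have h4 : inner ℝ (gradient φ u - gradient φ v) (s • d) ≤ M * t ^ 2 := by
    rw [inner_sub_left]; linarith
  rw [inner_smul_right] at h4
  have h5 : inner ℝ (gradient φ u - gradient φ v) d ≤ s⁻¹ * (M * t ^ 2) := by
    rw [← div_eq_inv_mul, le_div_iff₀ hspos]
    linarith
  refine h5.trans (le_of_eq ?_)
  rw [hs]
  field_simp

/-- A convex function that locally satisfies quadratic upper bounds on the relative interior of a
convex set has a gradient that is Lipschitz continuous in the directions of the set. -/
theorem ConvexOn.inner_gradient_sub_le [FiniteDimensional ℝ F] {S : Set F} {φ : F → ℝ} {M : ℝ}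
    (hφ : ConvexOn ℝ S φ) (hd : ∀ x ∈ S, DifferentiableAt ℝ φ x)
    (hc : ContinuousOn (gradient φ) S) (hM : 0 ≤ M)
    (hq : ∀ ε > 0, ∃ η > 0, ∀ x ∈ S, (∀ d ∈ vectorSpan ℝ S, ‖d‖ ≤ ε → x + d ∈ S) →
      ∀ d ∈ vectorSpan ℝ S, ‖d‖ ≤ η →
        φ (x + d) ≤ φ x + inner ℝ (gradient φ x) d + M / 2 * ‖d‖ ^ 2)
    {x z d : F} (hx : x ∈ S) (hz : z ∈ S) (hdm : d ∈ vectorSpan ℝ S) :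
    inner ℝ (gradient φ x - gradient φ z) d ≤ M * ‖x - z‖ * ‖d‖ := by
  have hS := hφ.1
  obtain ⟨x₀, hx₀, ε₀, hε₀, hball⟩ := hS.exists_forall_vectorSpan_add_mem ⟨x, hx⟩
  have hmem : ∀ l ∈ Set.Ioc (0 : ℝ) 1, ∀ w ∈ S, (1 - l) • w + l • x₀ ∈ S := fun l hl w hw =>
    hS hw hx₀ (sub_nonneg.2 hl.2) hl.1.le (by ring)
  -- Pulling a point towards the relative interior point `x₀` gives it room `l * ε₀` in all
  -- directions of the span; there the quadratic bounds hold with one radius `η`.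
  have hmargin : ∀ l ∈ Set.Ioc (0 : ℝ) 1, ∀ w ∈ S, ∀ d ∈ vectorSpan ℝ S, ‖d‖ ≤ l * ε₀ →
      (1 - l) • w + l • x₀ + d ∈ S := by
    intro l hl w hw d hd hdn
    have h1 : x₀ + l⁻¹ • d ∈ S := by
      refine hball _ (Submodule.smul_mem _ _ hd) ?_
      rw [norm_smul, norm_inv, Real.norm_of_nonneg hl.1.le, ← div_eq_inv_mul, div_le_iff₀ hl.1]
      linarith
    have h2 := hS hw h1 (sub_nonneg.2 hl.2) hl.1.le (by ring)
    rwa [smul_add, smul_inv_smul₀ hl.1.ne', ← add_assoc] at h2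
  have key : ∀ l ∈ Set.Ioc (0 : ℝ) 1,
      inner ℝ (gradient φ ((1 - l) • x + l • x₀) - gradient φ ((1 - l) • z + l • x₀)) d
        ≤ M * ‖x - z‖ * ‖d‖ := by
    intro l hl
    obtain ⟨η, hη, hquad⟩ := hq (l * ε₀) (mul_pos hl.1 hε₀)
    set ε := min η (l * ε₀) with hεdef
    have hε : 0 < ε := lt_min hη (mul_pos hl.1 hε₀)
    -- The local estimate is chained along the shifted segment, cut into `N` pieces shorter than
    -- `ε`; the constant does not grow.
    obtain ⟨N, hN⟩ := exists_nat_gt (‖x - z‖ / ε)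
    have hN0 : (0 : ℝ) < N := lt_of_le_of_lt (by positivity) hN
    have hstep : ‖x - z‖ / N ≤ ε := by
      rw [div_lt_iff₀ hε] at hN
      rw [div_le_iff₀ hN0]
      linarith
    set w : ℕ → F := fun i => (1 - (i / N : ℝ)) • x + (i / N : ℝ) • z with hw
    set pt : ℕ → F := fun i => (1 - l) • w i + l • x₀ with hpt
    have hwm : ∀ i ≤ N, w i ∈ S := by
      intro i hi
      have : (i : ℝ) / N ≤ 1 := by
        rw [div_le_one hN0]
        exact_mod_cast hi
      exact hS hx hz (sub_nonneg.2 this) (by positivity) (by ring)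
    have hdist : ∀ i, ‖pt i - pt (i + 1)‖ ≤ ‖x - z‖ / N := by
      intro i
      have : pt i - pt (i + 1) = ((1 - l) / N) • (x - z) := by
        simp only [hpt, hw]
        push_cast
        module
      rw [this, norm_smul, Real.norm_of_nonneg (div_nonneg (sub_nonneg.2 hl.2) hN0.le),
        div_mul_eq_mul_div]
      gcongr
      have := norm_nonneg (x - z)
      nlinarith [hl.1]
    have hloc : ∀ i < N, inner ℝ (gradient φ (pt i) - gradient φ (pt (i + 1))) d
        ≤ M * (‖x - z‖ / N) * ‖d‖ := by
      intro i hi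
      have h1 := hφ.inner_gradient_sub_le_of_near hd (hmem l hl _ (hwm i hi.le))
        (hmem l hl _ (hwm (i + 1) hi)) hdm (M := M) (ε := ε)
        (fun d hd hdn => hmargin l hl _ (hwm _ hi) d hd (hdn.trans (min_le_right _ _)))
        (fun d hd hdn => hquad _ (hmem l hl _ (hwm i hi.le)) (hmargin l hl _ (hwm i hi.le)) d hd
          (hdn.trans (min_le_left _ _)))
        (fun d hd hdn => hquad _ (hmem l hl _ (hwm _ hi)) (hmargin l hl _ (hwm _ hi)) d hd
          (hdn.trans (min_le_left _ _)))
        ((hdist i).trans hstep)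
      refine h1.trans ?_
      gcongr
      exact hdist i
    have hsum : ∀ j ≤ N, inner ℝ (gradient φ (pt 0) - gradient φ (pt j)) d
        ≤ j * (M * (‖x - z‖ / N) * ‖d‖) := by
      intro j
      induction j with
      | zero => intro _; simp
      | succ j ih =>
        intro hj
        have h1 := ih (by omega)
        have h2 := hloc j (by omega)
        rw [inner_sub_left] at h1 h2 ⊢
        push_cast
        linarith
    have hfin := hsum N le_rfl
    have e0 : pt 0 = (1 - l) • x + l • x₀ := by simp [hpt, hw]
    have eN : pt N = (1 - l) • z + l • x₀ := by simp [hpt, hw, hN0.ne']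
    rw [e0, eN] at hfin
    refine hfin.trans (le_of_eq ?_)
    field_simp
  -- The shift towards `x₀` is undone by continuity of the gradient.
  have hlim : ∀ w ∈ S, Tendsto (fun l : ℝ => gradient φ ((1 - l) • w + l • x₀)) (𝓝[>] 0)
      (𝓝 (gradient φ w)) := by
    intro w hw
    have h1 : Tendsto (fun l : ℝ => (1 - l) • w + l • x₀) (𝓝[>] 0) (𝓝 w) := by
      have : Continuous (fun l : ℝ => (1 - l) • w + l • x₀) := by fun_prop
      have h := this.tendsto 0
      simp only [sub_zero, one_smul, zero_smul, add_zero] at h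
      exact h.mono_left nhdsWithin_le_nhds
    refine (hc w hw).tendsto.comp (tendsto_nhdsWithin_iff.2 ⟨h1, ?_⟩)
    filter_upwards [Ioc_mem_nhdsGT (zero_lt_one' ℝ)] with l hl using hmem l hl w hw
  refine le_of_tendsto (((hlim x hx).sub (hlim z hz)).inner tendsto_const_nhds) ?_
  filter_upwards [Ioc_mem_nhdsGT (zero_lt_one' ℝ)] with l hl using key l hl

end Generic

/-! ### The augmented Lagrangian, its minimizers and the dual function. -/

namespace BlockProblem

variable {K m p : ℕ} {n s : Fin K → ℕ} (P : BlockProblem K m p n s)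

noncomputable def EmapL : FullVar n →L[ℝ] EuclideanSpace ℝ (Fin m) :=
  ∑ k, (P.E k).comp (PiLp.proj 2 (fun k : Fin K => Blk n k) k)

theorem EmapL_apply (x : FullVar n) : P.EmapL x = P.Emap x := by
  simp [EmapL, Emap]

theorem Emap_eq : P.Emap = P.EmapL := funext fun x => (P.EmapL_apply x).symm

theorem continuous_Emap : Continuous P.Emap := by
  rw [Emap_eq]
  exact P.EmapL.continuous

theorem Emap_sub (x z : FullVar n) : P.Emap (x - z) = P.Emap x - P.Emap z := by
  simp [Emap_eq]

theorem convex_XBlk (k : Fin K) : Convex ℝ (P.XBlk k) := by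
  intro v hv w hw a b ha hb hab i
  have h1 := hv i
  have h2 := hw i
  calc ∑ j, P.C k i j * (a • v + b • w) j
      = a * ∑ j, P.C k i j * v j + b * ∑ j, P.C k i j * w j := by
        rw [Finset.mul_sum, Finset.mul_sum, ← Finset.sum_add_distrib]
        refine Finset.sum_congr rfl (fun j _ => ?_)
        simp only [PiLp.add_apply, PiLp.smul_apply, smul_eq_mul]
        ring
    _ ≤ a * P.c k i + b * P.c k i := by gcongr
    _ = P.c k i := by rw [← add_mul, hab, one_mul]

theorem convex_X : Convex ℝ P.X := fun _ hx _ hz _ _ ha hb hab k =>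
  P.convex_XBlk k (hx k) (hz k) ha hb hab

theorem X_eq_preimage : P.X = (WithLp.ofLp : FullVar n → _) ⁻¹' Set.univ.pi P.XBlk := by
  ext x
  simp [X]

theorem isCompact_X (h : ∀ k, IsCompact (P.XBlk k)) : IsCompact P.X := by
  rw [X_eq_preimage]
  exact (PiLp.homeomorph 2 (fun k : Fin K => Blk n k)).isCompact_preimage.2
    (isCompact_univ_pi h)

theorem replaceBlock_apply_self (x : FullVar n) (k : Fin K) (v : Blk n k) :
    replaceBlock x k v k = v := by
  simp [replaceBlock]

theorem replaceBlock_apply_of_ne (x : FullVar n) {k j : Fin K} (h : j ≠ k) (v : Blk n k) :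
    replaceBlock x k v j = x j := by
  simp [replaceBlock, h]

variable {P} in
theorem replaceBlock_mem {x : FullVar n} (hx : x ∈ P.X) {k : Fin K} {v : Blk n k}
    (hv : v ∈ P.XBlk k) : replaceBlock x k v ∈ P.X := by
  intro j
  rcases eq_or_ne j k with rfl | h
  · rwa [replaceBlock_apply_self]
  · rw [replaceBlock_apply_of_ne _ h]
    exact hx j

theorem continuous_hBlk (k : Fin K) : Continuous (P.hBlk k) := by
  unfold hBlk
  refine Continuous.add (by fun_prop) (continuous_finsetSum _ fun J _ => ?_)
  refine continuous_const.mul (Real.continuous_sqrt.comp (continuous_finsetSum _ fun i _ => ?_))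
  split_ifs <;> fun_prop

theorem continuous_h : Continuous P.h := by
  unfold h
  exact continuous_finsetSum _ fun k _ => (P.continuous_hBlk k).comp (by fun_prop)

theorem convexOn_hBlk (k : Fin K) (hl : 0 ≤ P.lam k) (hw : ∀ J, 0 ≤ P.wt k J) :
    ConvexOn ℝ Set.univ (P.hBlk k) := by
  refine ⟨convex_univ, fun v _ w _ a b ha hb _ => ?_⟩
  have h1 : ∑ i, |(a • v + b • w) i| ≤ a * ∑ i, |v i| + b * ∑ i, |w i| := by
    rw [Finset.mul_sum, Finset.mul_sum, ← Finset.sum_add_distrib]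
    refine Finset.sum_le_sum (fun i _ => ?_)
    simp only [PiLp.add_apply, PiLp.smul_apply, smul_eq_mul]
    refine (abs_add_le _ _).trans ?_
    rw [abs_mul, abs_mul, abs_of_nonneg ha, abs_of_nonneg hb]
  have h2 : ∀ J, √(∑ i, if P.grp k i = J then ((a • v + b • w) i) ^ 2 else 0)
      ≤ a * √(∑ i, if P.grp k i = J then (v i) ^ 2 else 0)
        + b * √(∑ i, if P.grp k i = J then (w i) ^ 2 else 0) := by
    intro J
    -- The group seminorm is the norm of a coordinate projection, which makes the triangle
    -- inequality available.
    let T : Blk n k → Blk n k := fun v => WithLp.toLp 2 (fun i => if P.grp k i = J then v i else 0)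
    have hT : ∀ v : Blk n k, √(∑ i, if P.grp k i = J then (v i) ^ 2 else 0) = ‖T v‖ := by
      intro v
      rw [EuclideanSpace.norm_eq]
      congr 1
      refine Finset.sum_congr rfl (fun i _ => ?_)
      simp only [T]
      split_ifs <;> simp
    rw [hT, hT, hT]
    have : T (a • v + b • w) = a • T v + b • T w := by
      ext i
      simp only [T, PiLp.add_apply, PiLp.smul_apply, smul_eq_mul]
      split_ifs <;> simp
    rw [this]
    refine (norm_add_le _ _).trans ?_
    rw [norm_smul, norm_smul, Real.norm_of_nonneg ha, Real.norm_of_nonneg hb]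
  simp only [hBlk, smul_eq_mul]
  calc _ ≤ P.lam k * (a * ∑ i, |v i| + b * ∑ i, |w i|) + ∑ J, P.wt k J *
        (a * √(∑ i, if P.grp k i = J then (v i) ^ 2 else 0)
        + b * √(∑ i, if P.grp k i = J then (w i) ^ 2 else 0)) := by
        refine add_le_add (mul_le_mul_of_nonneg_left h1 hl) (Finset.sum_le_sum fun J _ => ?_)
        exact mul_le_mul_of_nonneg_left (h2 J) (hw J)
    _ = _ := by
      simp only [mul_add, Finset.sum_add_distrib, Finset.mul_sum]
      simp only [mul_left_comm]
      ring

variable {P}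

theorem AssumptionA.convexOn_hBlk (hA : P.AssumptionA) (k : Fin K) :
    ConvexOn ℝ (P.XBlk k) (P.hBlk k) :=
  (P.convexOn_hBlk k (hA.lam_nonneg k) (hA.wt_nonneg k)).subset (Set.subset_univ _)
    (P.convex_XBlk k)

theorem AssumptionA.convexOn_h (hA : P.AssumptionA) : ConvexOn ℝ P.X P.h := by
  refine ⟨P.convex_X, fun x hx z hz a b ha hb hab => ?_⟩
  simp only [h, smul_eq_mul, Finset.mul_sum, ← Finset.sum_add_distrib]
  refine Finset.sum_le_sum fun k _ => ?_
  exact (hA.convexOn_hBlk k).2 (hx k) (hz k) ha hb hab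

theorem contDiffOn_phi (hA : P.AssumptionA) : ContDiffOn ℝ 1 P.phi (interior P.dom) := by
  unfold phi
  refine hA.smooth_g.add ?_
  rw [Emap_eq]
  have : ContDiff ℝ 1 (fun x => P.rho / 2 * ‖P.EmapL x - P.q‖ ^ 2) :=
    contDiff_const.mul ((P.EmapL.contDiff.sub contDiff_const).norm_sq ℝ)
  exact this.contDiffOn

theorem differentiableAt_phi (hA : P.AssumptionA) (hX : P.X ⊆ interior P.dom) {x : FullVar n}
    (hx : x ∈ P.X) : DifferentiableAt ℝ P.phi x :=
  ((contDiffOn_phi hA).differentiableOn one_ne_zero).differentiableAt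
    (isOpen_interior.mem_nhds (hX hx))

theorem continuousOn_gradient_phi (hA : P.AssumptionA) (hX : P.X ⊆ interior P.dom) :
    ContinuousOn (gradient P.phi) P.X := by
  have h1 := ((contDiffOn_phi hA).continuousOn_fderiv_of_isOpen isOpen_interior le_rfl).mono hX
  exact (InnerProductSpace.toDual ℝ (FullVar n)).symm.continuous.comp_continuousOn h1

theorem continuousOn_phi (hA : P.AssumptionA) (hX : P.X ⊆ interior P.dom) :
    ContinuousOn P.phi P.X := (contDiffOn_phi hA).continuousOn.mono hX

theorem L_eq (x : FullVar n) (y : EuclideanSpace ℝ (Fin m)) :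
    P.L x y = P.phi x + P.h x + inner ℝ y (P.q - P.Emap x) := by
  simp only [L, f, phi]
  rw [norm_sub_rev]
  ring

theorem smoothL_eq (x : FullVar n) (y : EuclideanSpace ℝ (Fin m)) :
    P.smoothL x y = P.phi x + inner ℝ y (P.q - P.Emap x) := by
  simp only [smoothL, phi]
  rw [norm_sub_rev]
  ring

/-- The midpoint estimate expressing that `L(·; y)` is strongly convex as a function of `Ex`. -/
theorem L_midpoint_le (hA : P.AssumptionA) (hX : P.X ⊆ interior P.dom) {x z : FullVar n}
    (hx : x ∈ P.X) (hz : z ∈ P.X) (y : EuclideanSpace ℝ (Fin m)) :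
    P.L ((1 / 2 : ℝ) • x + (1 / 2 : ℝ) • z) y
      ≤ 1 / 2 * P.L x y + 1 / 2 * P.L z y - P.rho / 8 * ‖P.Emap x - P.Emap z‖ ^ 2 := by
  have hsub : P.X ⊆ P.dom := hX.trans interior_subset
  have h1 := hA.convex_g.2 (hsub hx) (hsub hz) (by norm_num : (0 : ℝ) ≤ 1 / 2)
    (by norm_num : (0 : ℝ) ≤ 1 / 2) (by norm_num)
  have h2 := hA.convexOn_h.2 hx hz (by norm_num : (0 : ℝ) ≤ 1 / 2)
    (by norm_num : (0 : ℝ) ≤ 1 / 2) (by norm_num)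
  have e1 : P.q - P.Emap ((1 / 2 : ℝ) • x + (1 / 2 : ℝ) • z)
      = (1 / 2 : ℝ) • ((P.q - P.Emap x) + (P.q - P.Emap z)) := by
    rw [Emap_eq, map_add, map_smul, map_smul]
    module
  have e2 : P.Emap x - P.Emap z = (P.q - P.Emap z) - (P.q - P.Emap x) := by abel
  have h3 := parallelogram_law_with_norm ℝ (P.q - P.Emap x) (P.q - P.Emap z)
  rw [norm_sub_rev (P.q - P.Emap x), ← e2] at h3
  have e3 : ‖P.q - P.Emap ((1 / 2 : ℝ) • x + (1 / 2 : ℝ) • z)‖ ^ 2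
      = 1 / 2 * ‖P.q - P.Emap x‖ ^ 2 + 1 / 2 * ‖P.q - P.Emap z‖ ^ 2
        - 1 / 4 * ‖P.Emap x - P.Emap z‖ ^ 2 := by
    rw [e1, norm_smul, Real.norm_of_nonneg (by norm_num)]
    linarith
  have e4 : inner ℝ y (P.q - P.Emap ((1 / 2 : ℝ) • x + (1 / 2 : ℝ) • z))
      = 1 / 2 * inner ℝ y (P.q - P.Emap x) + 1 / 2 * inner ℝ y (P.q - P.Emap z) := by
    rw [e1, inner_smul_right, inner_add_right]
    ring
  simp only [L, f]
  rw [e3, e4]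
  simp only [smul_eq_mul] at h1 h2
  linarith

/-- The minimizer is compared with the midpoint, whence twice the constant `ρ / 8`. In particular
`E` is constant on `X(y)`. -/
theorem L_add_le_of_mem_argminL (hA : P.AssumptionA) (hX : P.X ⊆ interior P.dom)
    {x z : FullVar n} {y : EuclideanSpace ℝ (Fin m)} (hx : x ∈ P.argminL y) (hz : z ∈ P.X) :
    P.L x y + P.rho / 4 * ‖P.Emap x - P.Emap z‖ ^ 2 ≤ P.L z y := by
  have h1 := L_midpoint_le hA hX hx.1 hz y
  have h2 := hx.2 _ (P.convex_X hx.1 hz (by norm_num : (0 : ℝ) ≤ 1 / 2)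
    (by norm_num : (0 : ℝ) ≤ 1 / 2) (by norm_num))
  linarith

theorem convexOn_phi (hA : P.AssumptionA) (hX : P.X ⊆ interior P.dom) :
    ConvexOn ℝ P.X P.phi := by
  have h1 : ConvexOn ℝ P.X P.g := hA.convex_g.subset (hX.trans interior_subset) P.convex_X
  refine h1.add ?_
  refine ConvexOn.smul (c := P.rho / 2) (by have := hA.rho_pos; positivity) ?_
  have h2 : ConvexOn ℝ P.X (fun x => ‖P.Emap x - P.q‖) := by
    refine ⟨P.convex_X, fun x _ z _ a b ha hb hab => ?_⟩
    have : P.Emap (a • x + b • z) - P.q = a • (P.Emap x - P.q) + b • (P.Emap z - P.q) := by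
      rw [Emap_eq, map_add, map_smul, map_smul]
      have : P.q = a • P.q + b • P.q := by rw [← add_smul, hab, one_smul]
      nth_rewrite 1 [this]
      module
    simp only [this, smul_eq_mul]
    refine (norm_add_le _ _).trans ?_
    rw [norm_smul, norm_smul, Real.norm_of_nonneg ha, Real.norm_of_nonneg hb]
  exact h2.pow (fun _ _ => norm_nonneg _) 2

theorem continuousOn_L (hA : P.AssumptionA) (hX : P.X ⊆ interior P.dom) :
    ContinuousOn (fun z : FullVar n × EuclideanSpace ℝ (Fin m) => P.L z.1 z.2)
      (P.X ×ˢ Set.univ) := by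
  simp only [L_eq]
  refine ContinuousOn.add (ContinuousOn.add ?_ ?_) ?_
  · exact (continuousOn_phi hA hX).comp continuousOn_fst (fun z hz => hz.1)
  · exact (P.continuous_h.comp continuous_fst).continuousOn
  · exact (continuous_snd.inner
      (continuous_const.sub (P.continuous_Emap.comp continuous_fst))).continuousOn

theorem continuousOn_L_left (hA : P.AssumptionA) (hX : P.X ⊆ interior P.dom)
    (y : EuclideanSpace ℝ (Fin m)) : ContinuousOn (fun x => P.L x y) P.X :=
  (continuousOn_L hA hX).comp (f := fun x => (x, y)) (by fun_prop) (fun _ hx => ⟨hx, trivial⟩)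

theorem AssumptionA.nonempty_X (hA : P.AssumptionA) : P.X.Nonempty :=
  hA.slater.mono fun _ hx => hx.1.1

theorem nonempty_argminL (hA : P.AssumptionA) (hX : P.X ⊆ interior P.dom)
    (y : EuclideanSpace ℝ (Fin m)) : (P.argminL y).Nonempty := by
  obtain ⟨x, hx, hmin⟩ := (P.isCompact_X hA.compact_X).exists_isMinOn hA.nonempty_X
    (continuousOn_L_left hA hX y)
  exact ⟨x, hx, fun z hz => hmin hz⟩

theorem isCompact_argminL (hA : P.AssumptionA) (hX : P.X ⊆ interior P.dom)
    (y : EuclideanSpace ℝ (Fin m)) : IsCompact (P.argminL y) := by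
  obtain ⟨x, hx⟩ := nonempty_argminL hA hX y
  have hXc := P.isCompact_X hA.compact_X
  have : P.argminL y = P.X ∩ (fun z => P.L z y) ⁻¹' Set.Iic (P.L x y) := by
    ext z
    refine ⟨fun hz => ⟨hz.1, hz.2 x hx.1⟩, fun hz => ⟨hz.1, fun w hw => ?_⟩⟩
    exact (Set.mem_Iic.1 hz.2).trans (hx.2 w hw)
  rw [this]
  exact hXc.of_isClosed_subset
    ((continuousOn_L_left hA hX y).preimage_isClosed_of_isClosed hXc.isClosed isClosed_Iic)
    Set.inter_subset_left

theorem exists_isNearest (hA : P.AssumptionA) (hX : P.X ⊆ interior P.dom) (x : FullVar n)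
    (y : EuclideanSpace ℝ (Fin m)) :
    ∃ z, P.IsNearest x y z ∧ ‖x - z‖ = Metric.infDist x (P.argminL y) := by
  obtain ⟨z, hz, hd⟩ := (isCompact_argminL hA hX y).exists_infDist_eq_dist
    (nonempty_argminL hA hX y) x
  rw [dist_eq_norm] at hd
  refine ⟨z, ⟨hz, fun z' hz' => ?_⟩, hd.symm⟩
  rw [norm_sub_rev, ← hd, norm_sub_rev, ← dist_eq_norm]
  exact Metric.infDist_le_dist_of_mem hz'

theorem dualFun_eq {x : FullVar n} {y : EuclideanSpace ℝ (Fin m)} (hx : x ∈ P.argminL y) :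
    P.dualFun y = P.L x y := by
  refine IsLeast.csInf_eq ⟨⟨x, hx.1, rfl⟩, ?_⟩
  rintro _ ⟨z, hz, rfl⟩
  exact hx.2 z hz

theorem dualFun_le (hA : P.AssumptionA) (hX : P.X ⊆ interior P.dom) {x : FullVar n}
    (hx : x ∈ P.X) (y : EuclideanSpace ℝ (Fin m)) : P.dualFun y ≤ P.L x y := by
  obtain ⟨z, hz⟩ := nonempty_argminL hA hX y
  rw [dualFun_eq hz]
  exact hz.2 x hx

/-- A minimizer of `L(·; b)` that satisfies the linear constraint is primal optimal, and `b` is then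
dual optimal. -/
theorem optimal_of_mem_argminL (hA : P.AssumptionA) (hX : P.X ⊆ interior P.dom) {a : FullVar n}
    {b : EuclideanSpace ℝ (Fin m)} (ha : a ∈ P.argminL b) (hE : P.Emap a = P.q) :
    P.IsPrimalOptimal a ∧ P.IsDualOptimal b := by
  have hL : ∀ z y, P.Emap z = P.q → P.L z y = P.f z := by
    intro z y hz
    simp [L, hz]
  refine ⟨⟨⟨ha.1, hE⟩, fun z hz hzE => ?_⟩, fun y' => ?_⟩
  · rw [← hL a b hE, ← hL z b hzE]
    exact ha.2 z hz
  · rw [dualFun_eq ha, hL a b hE, ← hL a y' hE]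
    exact dualFun_le hA hX ha.1 y'

theorem tendsto_L (hA : P.AssumptionA) (hX : P.X ⊆ interior P.dom) {l : Filter ℕ}
    {x : ℕ → FullVar n} {y : ℕ → EuclideanSpace ℝ (Fin m)} {a : FullVar n}
    {b : EuclideanSpace ℝ (Fin m)} (hx : ∀ r, x r ∈ P.X) (ha : a ∈ P.X) (hxa : Tendsto x l (𝓝 a))
    (hyb : Tendsto y l (𝓝 b)) : Tendsto (fun r => P.L (x r) (y r)) l (𝓝 (P.L a b)) := by
  have hmem : (a, b) ∈ P.X ×ˢ (Set.univ : Set (EuclideanSpace ℝ (Fin m))) :=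
    Set.mk_mem_prod ha (Set.mem_univ b)
  have hc := continuousOn_L hA hX (a, b) hmem
  unfold ContinuousWithinAt at hc
  have hxy : Tendsto (fun r => (x r, y r)) l (𝓝[P.X ×ˢ Set.univ] (a, b)) :=
    tendsto_nhdsWithin_iff.2 ⟨hxa.prodMk_nhds hyb,
      Eventually.of_forall fun r => Set.mk_mem_prod (hx r) (Set.mem_univ _)⟩
  have h := hc.comp hxy
  simp only [Function.comp_def] at h
  exact h

/-- The criterion by which the convergence of the iterates of both algorithms is shown. -/
theorem converges_of_tendsto (hA : P.AssumptionA) (hX : P.X ⊆ interior P.dom)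
    {x : ℕ → FullVar n} {y : ℕ → EuclideanSpace ℝ (Fin m)} (hx : ∀ r, x r ∈ P.X)
    (hstep : Tendsto (fun r => ‖x r - x (r + 1)‖) atTop (𝓝 0))
    (hdist : Tendsto (fun r => Metric.infDist (x r) (P.argminL (y r))) atTop (𝓝 0))
    (hres : ∀ z : ℕ → FullVar n, (∀ r, z r ∈ P.argminL (y r)) →
      Tendsto (fun r => ‖P.q - P.Emap (z r)‖) atTop (𝓝 0)) :
    P.Converges x y := by
  choose z hz hzd using fun r => exists_isNearest hA hX (x r) (y r)
  have hxz : Tendsto (fun r => ‖x r - z r‖) atTop (𝓝 0) := by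
    simpa only [hzd] using hdist
  have hxz' : Tendsto (fun r => z r - x r) atTop (𝓝 0) := by
    rw [tendsto_zero_iff_norm_tendsto_zero]
    simpa only [norm_sub_rev] using hxz
  have hE : Tendsto (fun r => ‖P.Emap (x r) - P.q‖) atTop (𝓝 0) := by
    rw [← tendsto_zero_iff_norm_tendsto_zero]
    have h1 := hres z (fun r => (hz r).1)
    rw [← tendsto_zero_iff_norm_tendsto_zero] at h1
    have h2 : Tendsto (fun r => P.EmapL (z r - x r)) atTop (𝓝 0) := by
      have h := (P.EmapL.continuous.tendsto 0).comp hxz'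
      rwa [map_zero] at h
    have h3 := (h1.add h2).neg
    simp only [add_zero, neg_zero] at h3
    refine h3.congr (fun r => ?_)
    rw [map_sub, EmapL_apply, EmapL_apply]
    abel
  refine ⟨hE, hstep, ⟨z, hz, hxz⟩, fun a b hab => ?_⟩
  -- An ultrafilter replaces the convergent subsequence.
  obtain ⟨U, hU, hUlim⟩ := mapClusterPt_iff_ultrafilter.1 hab
  have hxa : Tendsto x U (𝓝 a) := (continuous_fst.tendsto _).comp hUlim
  have hyb : Tendsto y U (𝓝 b) := (continuous_snd.tendsto _).comp hUlim
  have hza : Tendsto z U (𝓝 a) := by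
    have := hxa.add (hxz'.mono_left hU)
    simpa using this
  have haX : a ∈ P.X := (P.isCompact_X hA.compact_X).isClosed.mem_of_tendsto hxa
    (Eventually.of_forall hx)
  have haE : P.Emap a = P.q := by
    have h1 : Tendsto (fun r => P.Emap (x r) - P.q) U (𝓝 (P.Emap a - P.q)) :=
      ((P.continuous_Emap.tendsto a).comp hxa).sub tendsto_const_nhds
    have h2 := tendsto_zero_iff_norm_tendsto_zero.2 (hE.mono_left hU)
    exact sub_eq_zero.1 (tendsto_nhds_unique h1 h2)
  -- The nearest minimizers have the same limit `a`, and their minimality passes to the limit by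
  -- joint continuity of `L`.
  refine optimal_of_mem_argminL hA hX ⟨haX, fun w hw => ?_⟩ haE
  have h1 := tendsto_L hA hX (fun r => (hz r).1.1) haX hza hyb
  have h2 := tendsto_L hA hX (x := fun _ => w) (fun _ => hw) hw tendsto_const_nhds hyb
  exact le_of_tendsto_of_tendsto h1 h2 (Eventually.of_forall fun r => (hz r).1.2 w hw)

/-- The gradient `q - E x̄(y)` of the dual function is Lipschitz continuous. -/
theorem norm_Emap_sub_le (hA : P.AssumptionA) (hX : P.X ⊆ interior P.dom) {x x' : FullVar n}
    {y y' : EuclideanSpace ℝ (Fin m)} (hx : x ∈ P.argminL y) (hx' : x' ∈ P.argminL y') :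
    ‖P.Emap x - P.Emap x'‖ ≤ 2 / P.rho * ‖y - y'‖ := by
  have h1 := L_add_le_of_mem_argminL hA hX hx hx'.1
  have h2 := L_add_le_of_mem_argminL hA hX hx' hx.1
  rw [norm_sub_rev] at h2
  simp only [L_eq] at h1 h2
  -- Adding the two growth inequalities cancels everything but the terms bilinear in the multipliers
  -- and `E`.
  have h3 : P.rho / 2 * ‖P.Emap x - P.Emap x'‖ ^ 2 ≤ inner ℝ (y - y') (P.Emap x - P.Emap x') := by
    simp only [inner_sub_left, inner_sub_right] at h1 h2 ⊢
    linarith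
  have h4 := h3.trans (real_inner_le_norm _ _)
  have hρ := hA.rho_pos
  rcases (norm_nonneg (P.Emap x - P.Emap x')).eq_or_lt with h0 | h0
  · rw [← h0]
    positivity
  · have h5 : P.rho / 2 * ‖P.Emap x - P.Emap x'‖ ≤ ‖y - y'‖ := by
      refine le_of_mul_le_mul_right ?_ h0
      linarith
    rw [div_mul_eq_mul_div, le_div_iff₀ hρ]
    linarith

end BlockProblem

/-! ### Uniform constants over the blocks, and changes of a single block. -/

theorem exists_pos_forall_le {ι : Type*} [Finite ι] {f : ι → ℝ} (hf : ∀ i, 0 < f i) :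
    ∃ c > 0, ∀ i, c ≤ f i := by
  cases isEmpty_or_nonempty ι
  · exact ⟨1, one_pos, fun i => isEmptyElim i⟩
  · obtain ⟨i, hi⟩ := Finite.exists_min f
    exact ⟨f i, hf i, hi⟩

theorem exists_forall_le_of_pos {ι : Type*} [Finite ι] {f : ι → ℝ} (hf : ∀ i, 0 < f i) :
    ∃ c > 0, ∀ i, f i ≤ c := by
  cases isEmpty_or_nonempty ι
  · exact ⟨1, one_pos, fun i => isEmptyElim i⟩
  · obtain ⟨i, hi⟩ := Finite.exists_max f
    exact ⟨f i, hf i, hi⟩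

section Generic

variable {F : Type*} [NormedAddCommGroup F] [InnerProductSpace ℝ F] [CompleteSpace F]

theorem hasGradientAt_half_norm_sub_sq (v z : F) :
    HasGradientAt (fun z => 1 / 2 * ‖v - z‖ ^ 2) (z - v) z := by
  rw [hasGradientAt_iff_hasFDerivAt]
  have h := (((hasFDerivAt_const v z).sub (hasFDerivAt_id z)).norm_sq).const_mul (1 / 2 : ℝ)
  refine h.congr_fderiv ?_
  ext d
  simp

end Generic

section Blocks

variable {K : ℕ} {n : Fin K → ℕ}

theorem inner_replaceBlock_sub (G z : FullVar n) (k : Fin K) (v : Blk n k) :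
    inner ℝ G (replaceBlock z k v - z) = inner ℝ (G k) (v - z k) := by
  rw [PiLp.inner_apply, Finset.sum_eq_single k]
  · simp [replaceBlock]
  · intro j _ hj
    simp [replaceBlock, hj]
  · simp

theorem norm_replaceBlock_sub (z : FullVar n) (k : Fin K) (v : Blk n k) :
    ‖replaceBlock z k v - z‖ = ‖v - z k‖ := by
  have h : ‖replaceBlock z k v - z‖ ^ 2 = ‖v - z k‖ ^ 2 := by
    rw [← real_inner_self_eq_norm_sq, ← real_inner_self_eq_norm_sq, inner_replaceBlock_sub]
    simp [replaceBlock]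
  exact (pow_left_inj₀ (norm_nonneg _) (norm_nonneg _) two_ne_zero).1 h

theorem sum_replaceBlock_zero (d : FullVar n) : ∑ k, replaceBlock 0 k (d k) = d := by
  ext j i
  rw [WithLp.ofLp_sum, Finset.sum_apply, Finset.sum_eq_single j]
  · simp [replaceBlock]
  · intro k _ hk
    simp [replaceBlock, hk.symm]
  · simp

theorem norm_le_sum_norm_block (d : FullVar n) : ‖d‖ ≤ ∑ k, ‖d k‖ := by
  conv_lhs => rw [← sum_replaceBlock_zero d]
  refine (norm_sum_le _ _).trans (Finset.sum_le_sum fun k _ => ?_)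
  have := norm_replaceBlock_sub (0 : FullVar n) k (d k)
  simpa using this.le

theorem norm_block_le (d : FullVar n) (k : Fin K) : ‖d k‖ ≤ ‖d‖ := PiLp.norm_apply_le d k

theorem norm_sq_eq_sum_block (d : FullVar n) : ‖d‖ ^ 2 = ∑ k, ‖d k‖ ^ 2 :=
  PiLp.norm_sq_eq_of_L2 _ d

theorem replaceBlock_add_smul (x d : FullVar n) (k : Fin K) (c : ℝ) :
    replaceBlock x k (x k + c • d k) = x + c • replaceBlock 0 k (d k) := by
  ext j i
  rcases eq_or_ne j k with rfl | h
  · simp [replaceBlock]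
  · simp [replaceBlock, h]

end Blocks

/-! ### Block subproblems, smoothness of `φ`, and the error bound in terms of the move. -/

namespace BlockProblem

variable {K m p : ℕ} {n s : Fin K → ℕ} {P : BlockProblem K m p n s}
  {u : (k : Fin K) → Blk n k → FullVar n → ℝ}

theorem h_replaceBlock (w : FullVar n) (k : Fin K) (v : Blk n k) :
    P.h (replaceBlock w k v) = P.h w + (P.hBlk k v - P.hBlk k (w k)) := by
  rw [← sub_eq_iff_eq_add', h, h, ← Finset.sum_sub_distrib, Finset.sum_eq_single k]
  · rw [replaceBlock_apply_self]
  · intro j _ hj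
    rw [replaceBlock_apply_of_ne _ hj, sub_self]
  · simp

theorem Emap_replaceBlock (w : FullVar n) (k : Fin K) (v : Blk n k) :
    P.Emap (replaceBlock w k v) = P.Emap w + P.E k (v - w k) := by
  rw [← sub_eq_iff_eq_add', Emap, Emap, ← Finset.sum_sub_distrib, Finset.sum_eq_single k]
  · rw [replaceBlock_apply_self, map_sub]
  · intro j _ hj
    rw [replaceBlock_apply_of_ne _ hj, sub_self]
  · simp

/-- `X` is a product: the block component of a difference `a - b` is the difference of two points of
`X`, namely `b` with its block taken from `a`, and `b` itself. -/
theorem replaceBlock_zero_mem_vectorSpan {d : FullVar n} (hd : d ∈ vectorSpan ℝ P.X) (k : Fin K) :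
    replaceBlock 0 k (d k) ∈ vectorSpan ℝ P.X := by
  have hadd : ∀ a b : FullVar n, replaceBlock 0 k ((a + b) k)
      = replaceBlock 0 k (a k) + replaceBlock 0 k (b k) := by
    intro a b
    ext j i
    rcases eq_or_ne j k with rfl | h
    · simp [replaceBlock]
    · simp [replaceBlock, h]
  have hsmul : ∀ (c : ℝ) (a : FullVar n), replaceBlock 0 k ((c • a) k)
      = c • replaceBlock 0 k (a k) := by
    intro c a
    ext j i
    rcases eq_or_ne j k with rfl | h
    · simp [replaceBlock]
    · simp [replaceBlock, h]
  refine Submodule.span_induction (p := fun d _ => replaceBlock 0 k (d k) ∈ vectorSpan ℝ P.X)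
    ?_ ?_ ?_ ?_ hd
  · rintro _ ⟨a, ha, b, hb, rfl⟩
    have : replaceBlock 0 k ((a -ᵥ b) k) = replaceBlock b k (a k) -ᵥ b := by
      ext j i
      rcases eq_or_ne j k with rfl | h
      · simp [replaceBlock]
      · simp [replaceBlock, h]
    simp only [this]
    exact vsub_mem_vectorSpan ℝ (replaceBlock_mem hb (ha k)) hb
  · have : replaceBlock 0 k ((0 : FullVar n) k) = 0 := by simpa using hsmul 0 0
    rw [this]
    exact Submodule.zero_mem _
  · intro a b _ _ h1 h2
    rw [hadd]
    exact Submodule.add_mem _ h1 h2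
  · intro c a _ h1
    rw [hsmul]
    exact Submodule.smul_mem _ _ h1

/-- The variational inequality of the block subproblem. -/
theorem IsBlockArgmin.sub_le_inner (hA : P.AssumptionA) (hB : P.AssumptionB u) {k : Fin K}
    {w : FullVar n} {y : EuclideanSpace ℝ (Fin m)} {v v' : Blk n k} (hw : w ∈ P.X)
    (hv : P.IsBlockArgmin u k w y v) (hv' : v' ∈ P.XBlk k) :
    P.hBlk k v - P.hBlk k v' ≤
      inner ℝ (gradient (fun z => u k z w) v) (v' - v) - inner ℝ y (P.E k (v' - v)) := by
  -- The linear term is counted with the convex part, so that only `u k` is differentiated.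
  have hlin : ConcaveOn ℝ (P.XBlk k) (fun v => inner ℝ y (P.E k v)) :=
    ((innerSL ℝ y).comp (P.E k)).toLinearMap.concaveOn (P.convex_XBlk k)
  have hH := (hA.convexOn_hBlk k).sub hlin
  have := hH.sub_le_inner_gradient_of_isMin hv.1 hv' (hB.diff k w hw v hv.1) (fun z hz => by
    have := hv.2 z hz
    simp only [Pi.sub_apply]
    linarith)
  simp only [Pi.sub_apply] at this
  rw [map_sub, inner_sub_right y]
  linarith

/-- The objective of the block subproblem grows quadratically away from its minimizer. -/
theorem IsBlockArgmin.add_le {γ : ℝ} (hA : P.AssumptionA) (hB : P.AssumptionB u) {k : Fin K}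
    (hγ : ∀ x ∈ P.X, ∀ v ∈ P.XBlk k, ∀ v' ∈ P.XBlk k,
      u k v' x + inner ℝ (gradient (fun z => u k z x) v') (v - v') + γ / 2 * ‖v - v'‖ ^ 2 ≤ u k v x)
    {w : FullVar n} {y : EuclideanSpace ℝ (Fin m)} {v v' : Blk n k} (hw : w ∈ P.X)
    (hv : P.IsBlockArgmin u k w y v) (hv' : v' ∈ P.XBlk k) :
    u k v w - inner ℝ y (P.E k v) + P.hBlk k v + γ / 2 * ‖v' - v‖ ^ 2
      ≤ u k v' w - inner ℝ y (P.E k v') + P.hBlk k v' := by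
  have h1 := hv.sub_le_inner hA hB hw hv'
  have h2 := hγ w hw v' hv' v hv.1
  rw [map_sub, inner_sub_right y] at h1
  linarith

/-- Uniqueness makes the random iterates functions of the draws and identifies their updates with a
fixed choice of minimizers. -/
theorem IsBlockArgmin.eq (hA : P.AssumptionA) (hB : P.AssumptionB u) {k : Fin K}
    {w : FullVar n} {y : EuclideanSpace ℝ (Fin m)} {v v' : Blk n k} (hw : w ∈ P.X)
    (hv : P.IsBlockArgmin u k w y v) (hv' : P.IsBlockArgmin u k w y v') : v = v' := by
  obtain ⟨γ, hγ0, hγ⟩ := hB.strong k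
  have h1 := hv.add_le hA hB hγ hw hv'.1
  have h2 := hv'.2 v hv.1
  have h3 : ‖v' - v‖ ^ 2 ≤ 0 := by
    by_contra hh
    push Not at hh
    have := mul_pos (half_pos hγ0) hh
    linarith
  have h4 : ‖v' - v‖ = 0 := pow_eq_zero_iff two_ne_zero |>.1 (le_antisymm h3 (sq_nonneg _))
  exact (sub_eq_zero.1 (norm_eq_zero.1 h4)).symm

theorem exists_isBlockArgmin (hA : P.AssumptionA) (hB : P.AssumptionB u) (k : Fin K)
    {w : FullVar n} (hw : w ∈ P.X) (y : EuclideanSpace ℝ (Fin m)) :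
    ∃ v, P.IsBlockArgmin u k w y v := by
  have hc : ContinuousOn (fun v => u k v w - inner ℝ y (P.E k v) + P.hBlk k v) (P.XBlk k) := by
    refine ContinuousOn.add (ContinuousOn.sub ?_ ?_) (P.continuous_hBlk k).continuousOn
    · exact (hB.cont k).comp (f := fun v => (v, w)) (by fun_prop) (fun v hv => ⟨hv, hw⟩)
    · exact (continuous_const.inner (P.E k).continuous).continuousOn
  obtain ⟨v, hv, hmin⟩ := (hA.compact_X k).exists_isMinOn ⟨w k, hw k⟩ hc
  exact ⟨v, hv, fun v' hv' => hmin hv'⟩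

/-- A block update decreases the augmented Lagrangian. -/
theorem IsBlockArgmin.L_replaceBlock_le {γ : ℝ} (hA : P.AssumptionA) (hB : P.AssumptionB u)
    {k : Fin K}
    (hγ : ∀ x ∈ P.X, ∀ v ∈ P.XBlk k, ∀ v' ∈ P.XBlk k,
      u k v' x + inner ℝ (gradient (fun z => u k z x) v') (v - v') + γ / 2 * ‖v - v'‖ ^ 2 ≤ u k v x)
    {w : FullVar n} {y : EuclideanSpace ℝ (Fin m)} {v : Blk n k} (hw : w ∈ P.X)
    (hv : P.IsBlockArgmin u k w y v) :
    P.L (replaceBlock w k v) y + γ / 2 * ‖v - w k‖ ^ 2 ≤ P.L w y := by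
  have h1 := hv.add_le hA hB hγ hw (hw k)
  rw [hB.tight k w hw, norm_sub_rev] at h1
  have h2 := hB.upper k w hw v hv.1
  rw [L_eq, L_eq, h_replaceBlock, Emap_replaceBlock, map_sub]
  simp only [inner_sub_right, inner_add_right] at h1 ⊢
  linarith

/-- The tangent of the convex `u k` at `v`, evaluated at `x k`, bounds `u k v x`; moving its slope
back to `x k` costs `Lk ‖v - x k‖²`. This avoids integrating the gradient, at the price of a factor
two. -/
theorem u_le_quadratic {Lk : ℝ} (hB : P.AssumptionB u) {k : Fin K}
    (hL : ∀ x ∈ P.X, ∀ v ∈ P.XBlk k, ∀ v' ∈ P.XBlk k,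
      ‖gradient (fun z => u k z x) v - gradient (fun z => u k z x) v'‖ ≤ Lk * ‖v - v'‖)
    {x : FullVar n} {v : Blk n k} (hx : x ∈ P.X) (hv : v ∈ P.XBlk k) :
    u k v x ≤ P.phi x + inner ℝ ((gradient P.phi x) k) (v - x k) + Lk * ‖v - x k‖ ^ 2 := by
  obtain ⟨γ, hγ0, hγ⟩ := hB.strong k
  have h1 := hγ x hx (x k) (hx k) v hv
  rw [hB.tight k x hx] at h1
  have h2 := hL x hx v hv (x k) (hx k)
  rw [hB.grad_eq k x hx] at h2
  have h3 := (real_inner_le_norm (gradient (fun z => u k z x) v - gradient P.phi x k)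
    (v - x k)).trans (mul_le_mul_of_nonneg_right h2 (norm_nonneg _))
  rw [inner_sub_left] at h3
  have h4 : 0 ≤ γ / 2 * ‖x k - v‖ ^ 2 := by positivity
  rw [← neg_sub v (x k), inner_neg_right] at h1
  nlinarith

/-- The gradient of `φ` is Lipschitz continuous on `X` in the directions of `X`. -/
theorem exists_inner_gradient_phi_sub_le (hA : P.AssumptionA) (hB : P.AssumptionB u) :
    ∃ M ≥ 0, ∀ x ∈ P.X, ∀ z ∈ P.X, ∀ d ∈ vectorSpan ℝ P.X,
      inner ℝ (gradient P.phi x - gradient P.phi z) d ≤ M * ‖x - z‖ * ‖d‖ := by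
  choose Lk hLk0 hLk using hB.lip
  obtain ⟨Λ, hΛ0, hΛ⟩ := exists_forall_le_of_pos hLk0
  refine ⟨2 * (K * Λ), by positivity, fun x hx z hz d hd => ?_⟩
  have hX := hB.X_subset
  refine (convexOn_phi hA hX).inner_gradient_sub_le (fun x hx => differentiableAt_phi hA hX hx)
    (continuousOn_gradient_phi hA hX) (by positivity) ?_ hx hz hd
  intro ε hε
  -- Jensen's inequality below uses points displaced by `K` times a block of `d`, so `d` must be
  -- shorter than the margin by this factor.
  refine ⟨ε / (K + 1), by positivity, fun x hx hball d hd hdn => ?_⟩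
  rcases Nat.eq_zero_or_pos K with hK | hK
  · subst hK
    have : d = 0 := by
      ext k
      exact k.elim0
    simp [this]
  have hK0 : (0 : ℝ) < K := by exact_mod_cast hK
  have hmem : ∀ k, x + (K : ℝ) • replaceBlock 0 k (d k) ∈ P.X := by
    intro k
    refine hball _ (Submodule.smul_mem _ _ (replaceBlock_zero_mem_vectorSpan hd k)) ?_
    have h1 := norm_replaceBlock_sub (0 : FullVar n) k (d k)
    simp only [sub_zero, PiLp.zero_apply] at h1
    rw [norm_smul, h1, Real.norm_of_nonneg hK0.le]
    rw [le_div_iff₀ (by positivity)] at hdn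
    have h2 := norm_block_le d k
    have h3 := norm_nonneg d
    nlinarith
  -- A joint move is the average of `K` single-block moves stretched by `K`; to each of these the
  -- bound through `u k` applies.
  have hsum : x + d = ∑ k, (1 / K : ℝ) • (x + (K : ℝ) • replaceBlock 0 k (d k)) := by
    rw [← Finset.smul_sum, Finset.sum_add_distrib, ← Finset.smul_sum, sum_replaceBlock_zero]
    simp only [Finset.sum_const, Finset.card_univ, Fintype.card_fin, ← Nat.cast_smul_eq_nsmul ℝ]
    rw [smul_add, smul_smul, smul_smul, one_div_mul_cancel hK0.ne', one_smul, one_smul]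
  have hterm : ∀ k, P.phi (x + (K : ℝ) • replaceBlock 0 k (d k)) ≤
      P.phi x + K * inner ℝ ((gradient P.phi x) k) (d k) + Λ * (K ^ 2 * ‖d k‖ ^ 2) := by
    intro k
    have hm := hmem k
    rw [← replaceBlock_add_smul] at hm ⊢
    have hv : x k + (K : ℝ) • d k ∈ P.XBlk k := by
      have := hm k
      rwa [replaceBlock_apply_self] at this
    refine (hB.upper k x hx _ hv).trans ((u_le_quadratic hB (hLk k) hx hv).trans ?_)
    rw [add_sub_cancel_left, inner_smul_right, norm_smul, mul_pow, Real.norm_of_nonneg hK0.le]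
    gcongr
    exact hΛ k
  have hJ := (convexOn_phi hA hX).map_sum_le (t := Finset.univ) (w := fun _ : Fin K => (1 / K : ℝ))
    (p := fun k => x + (K : ℝ) • replaceBlock 0 k (d k)) (fun _ _ => by positivity)
    (by simp [hK0.ne']) (fun k _ => hmem k)
  rw [← hsum] at hJ
  refine hJ.trans ?_
  calc ∑ k, (1 / K : ℝ) • P.phi (x + (K : ℝ) • replaceBlock 0 k (d k))
      ≤ ∑ k : Fin K, (1 / K : ℝ) * (P.phi x + K * inner ℝ ((gradient P.phi x) k) (d k)
        + Λ * (K ^ 2 * ‖d k‖ ^ 2)) := by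
        refine Finset.sum_le_sum fun k _ => ?_
        rw [smul_eq_mul]
        gcongr
        exact hterm k
    _ = P.phi x + inner ℝ (gradient P.phi x) d + 2 * (K * Λ) / 2 * ‖d‖ ^ 2 := by
        rw [← Finset.mul_sum, Finset.sum_add_distrib, Finset.sum_add_distrib, ← Finset.mul_sum,
          ← Finset.mul_sum, ← Finset.mul_sum, PiLp.inner_apply, norm_sq_eq_sum_block]
        simp only [Finset.sum_const, Finset.card_univ, Fintype.card_fin, nsmul_eq_mul]
        field_simp

theorem inner_gradient_smoothL (hA : P.AssumptionA) (hX : P.X ⊆ interior P.dom) {x : FullVar n}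
    (hx : x ∈ P.X) (y : EuclideanSpace ℝ (Fin m)) (d : FullVar n) :
    inner ℝ (gradient (fun z => P.smoothL z y) x) d
      = inner ℝ (gradient P.phi x) d - inner ℝ y (P.Emap d) := by
  rw [inner_gradient_left, inner_gradient_left]
  have h1 : HasFDerivAt (fun z => P.smoothL z y)
      (fderiv ℝ P.phi x + (innerSL ℝ y).comp (-P.EmapL)) x := by
    simp only [smoothL_eq]
    refine (differentiableAt_phi hA hX hx).hasFDerivAt.add ?_
    have h2 : HasFDerivAt (fun z => P.q - P.Emap z) (-P.EmapL) x := by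
      rw [Emap_eq]
      exact P.EmapL.hasFDerivAt.const_sub P.q
    exact (innerSL ℝ y).hasFDerivAt.comp x h2
  rw [h1.fderiv]
  simp [EmapL_apply, sub_eq_add_neg]

theorem exists_isProx (hA : P.AssumptionA) (v : FullVar n) : ∃ z, P.IsProx v z := by
  have hc : Continuous (fun z => P.h z + 1 / 2 * ‖v - z‖ ^ 2) :=
    P.continuous_h.add (by fun_prop)
  obtain ⟨z, hz, hmin⟩ := (P.isCompact_X hA.compact_X).exists_isMinOn hA.nonempty_X hc.continuousOn
  exact ⟨z, hz, fun w hw => hmin hw⟩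

/-- The error bound extends to all of the bounded set `X`. -/
theorem ErrorBound.exists_forall (hA : P.AssumptionA) (hX : P.X ⊆ interior P.dom)
    (hEB : P.ErrorBound) : ∃ τ > 0, ∀ y, ∀ x ∈ P.X, ∀ w, P.IsProxGradient x y w →
      Metric.infDist x (P.argminL y) ≤ τ * ‖w‖ := by
  obtain ⟨τ, δ, hτ, hδ, h⟩ := hEB
  obtain ⟨R, hR⟩ := Metric.isBounded_iff.1 (P.isCompact_X hA.compact_X).isBounded
  have hR0 : 0 ≤ R := by
    obtain ⟨x, hx⟩ := hA.nonempty_X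
    exact dist_nonneg.trans (hR hx hx)
  -- Where the proximal gradient exceeds `δ`, the diameter bound `R` suffices.
  refine ⟨τ + R / δ, by positivity, fun y x hx w hw => ?_⟩
  rcases le_total ‖w‖ δ with hwδ | hwδ
  · refine (h y x hx w hw hwδ).trans ?_
    gcongr
    have : 0 ≤ R / δ := by positivity
    linarith
  · obtain ⟨z, hz⟩ := nonempty_argminL hA hX y
    calc Metric.infDist x (P.argminL y) ≤ dist x z := Metric.infDist_le_dist_of_mem hz
      _ ≤ R := hR hx hz.1
      _ = R / δ * δ := by field_simp
      _ ≤ (τ + R / δ) * ‖w‖ := by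
        have : 0 ≤ R / δ := by positivity
        gcongr
        linarith

/-- The distance to `X(y)` is bounded by the length of a step of block updates. -/
theorem exists_infDist_argminL_le (hA : P.AssumptionA) (hB : P.AssumptionB u)
    (hEB : P.ErrorBound) : ∃ C > 0, ∀ y, ∀ x ∈ P.X, ∀ x' : FullVar n,
      (∀ k, ∃ w ∈ P.X, w k = x k ∧ ‖w - x‖ ≤ ‖x' - x‖ ∧ P.IsBlockArgmin u k w y (x' k)) →
      Metric.infDist x (P.argminL y) ≤ C * ‖x' - x‖ := by
  have hX := hB.X_subset
  obtain ⟨τ, hτ, hdist⟩ := hEB.exists_forall hA hX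
  obtain ⟨M, hM, hlip⟩ := exists_inner_gradient_phi_sub_le hA hB
  choose Lk hLk0 hLk using hB.lip
  obtain ⟨Λ, hΛ0, hΛ⟩ := exists_forall_le_of_pos hLk0
  -- `K + 1` instead of `K` keeps the constant positive when there are no blocks.
  refine ⟨τ * ((K + 1) * (2 + M + Λ)), by positivity, fun y x hx x' hx' => ?_⟩
  obtain ⟨z, hz⟩ := exists_isProx hA (x - gradient (fun z => P.smoothL z y) x)
  have hpg : P.IsProxGradient x y (x - z) := by
    unfold IsProxGradient
    rwa [sub_sub_cancel]
  refine (hdist y x hx _ hpg).trans ?_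
  rw [mul_assoc]
  refine mul_le_mul_of_nonneg_left ?_ hτ.le
  -- The variational inequality of the prox point `z`, tested at `z` with block `x' k`, is added to
  -- that of the block subproblem, tested at `z k`. The terms in `h` and `y` cancel, and only
  -- gradient differences and the move bound `e`.
  have hblock : ∀ k, ‖(x - z) k‖ ≤ (2 + M + Λ) * ‖x' - x‖ := by
    intro k
    obtain ⟨w, hw, hwk, hwx, hmin⟩ := hx' k
    set e : Blk n k := x' k - z k with he
    have hzr : replaceBlock z k (x' k) ∈ P.X := replaceBlock_mem hz.1 hmin.1
    have hgrad := hasGradientAt_half_norm_sub_sq (x - gradient (fun z => P.smoothL z y) x) z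
    have h1 := hA.convexOn_h.sub_le_inner_gradient_of_isMin hz.1 hzr
      hgrad.differentiableAt (fun w' hw' => by
        have := hz.2 w' hw'
        linarith)
    rw [hgrad.gradient, h_replaceBlock, sub_sub_eq_add_sub,
      inner_sub_left, inner_add_left, inner_gradient_smoothL hA hX hx, inner_replaceBlock_sub,
      inner_replaceBlock_sub, inner_replaceBlock_sub, Emap_sub, Emap_replaceBlock,
      add_sub_cancel_left, ← he] at h1
    have h2 := hmin.sub_le_inner hA hB hw (hz.1 k)
    have h3 : inner ℝ (gradient P.phi x - gradient P.phi w) (replaceBlock z k (x' k) - z)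
        ≤ M * ‖x - w‖ * ‖replaceBlock z k (x' k) - z‖ :=
      hlip x hx w hw _ (vsub_mem_vectorSpan ℝ hzr hz.1)
    rw [inner_sub_left, inner_replaceBlock_sub, inner_replaceBlock_sub, norm_replaceBlock_sub,
      ← he, norm_sub_rev] at h3
    have h4 := hLk k w hw (x' k) hmin.1 (w k) (hw k)
    rw [hB.grad_eq k w hw, norm_sub_rev] at h4
    have h5 := (real_inner_le_norm (gradient P.phi w k - gradient (fun z => u k z w) (x' k))
      e).trans (mul_le_mul_of_nonneg_right h4 (norm_nonneg e))
    rw [inner_sub_left, hwk] at h5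
    have h6 : ‖x' k - x k‖ ≤ ‖x' - x‖ := norm_block_le (x' - x) k
    have h7 := real_inner_le_norm (x' k - x k) e
    -- The quadratic term of the prox produces the `‖e‖²` to be estimated.
    have h8 : inner ℝ (z k) e = inner ℝ (x k) e + inner ℝ (x' k - x k) e - ‖e‖ ^ 2 := by
      rw [← real_inner_self_eq_norm_sq, ← inner_add_left, ← inner_sub_left]
      congr 1
      rw [he]
      abel
    rw [← neg_sub (x' k) (z k), ← he, map_neg, inner_neg_right, inner_neg_right] at h2
    have hLam := hΛ k
    have h9 : Lk k * ‖x' k - x k‖ ≤ Λ * ‖x' - x‖ := by gcongr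
    have h10 : ‖e‖ ^ 2 ≤ (1 + M + Λ) * ‖x' - x‖ * ‖e‖ := by
      have i1 : ‖x' k - x k‖ * ‖e‖ ≤ ‖x' - x‖ * ‖e‖ := by gcongr
      have i2 : M * ‖w - x‖ * ‖e‖ ≤ M * ‖x' - x‖ * ‖e‖ := by gcongr
      have i3 : Lk k * ‖x' k - x k‖ * ‖e‖ ≤ Λ * ‖x' - x‖ * ‖e‖ := by gcongr
      linarith
    have h11 : ‖e‖ ≤ (1 + M + Λ) * ‖x' - x‖ := by
      rcases (norm_nonneg e).eq_or_lt with h0 | h0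
      · rw [← h0]
        positivity
      · refine le_of_mul_le_mul_right ?_ h0
        linarith
    have h12 : (x - z) k = e - (x' k - x k) := by
      rw [he]
      simp
    rw [h12]
    refine (norm_sub_le _ _).trans ?_
    linarith
  calc ‖x - z‖ ≤ ∑ k, ‖(x - z) k‖ := norm_le_sum_norm_block _
    _ ≤ ∑ _k : Fin K, (2 + M + Λ) * ‖x' - x‖ := Finset.sum_le_sum fun k _ => hblock k
    _ = K * ((2 + M + Λ) * ‖x' - x‖) := by simp
    _ ≤ (K + 1) * (2 + M + Λ) * ‖x' - x‖ := by
      rw [mul_assoc]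
      gcongr
      linarith

end BlockProblem

/-! ### Consequences of the stepsize rules. -/

theorem StepsizeRule.exists_forall_lt {abar : ℝ} {α : ℕ → ℝ} (h : StepsizeRule abar α)
    (h0 : 0 < abar) : ∃ T, ∀ r, T ≤ r → α r < abar := by
  obtain ⟨_, ⟨a, ha, hαa⟩ | ⟨_, hlim⟩⟩ := h
  · exact ⟨0, fun r _ => by rwa [hαa r]⟩
  · exact eventually_atTop.1 (hlim.eventually_lt_const h0)

theorem tendsto_zero_of_summable_const_mul_sq {a : ℝ} {c : ℕ → ℝ} (ha : 0 < a) (hc : ∀ r, 0 ≤ c r)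
    (hs : Summable (fun r => a * c r ^ 2)) : Tendsto c atTop (𝓝 0) := by
  have h := (hs.tendsto_atTop_zero.const_mul a⁻¹).sqrt
  simpa only [inv_mul_cancel_left₀ ha.ne', Real.sqrt_sq (hc _), mul_zero, Real.sqrt_zero] using h

theorem StepsizeRule.tendsto_zero {abar C : ℝ} {α b : ℕ → ℝ} (h : StepsizeRule abar α)
    (hb : ∀ r, 0 ≤ b r) (hC : ∀ r, |b (r + 1) - b r| ≤ C * α r)
    (hs : Summable (fun r => α r * b r ^ 2) ∨ Summable (fun r => α r * b (r + 1) ^ 2)) :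
    Tendsto b atTop (𝓝 0) := by
  obtain ⟨hα, ⟨a, _, hαa⟩ | ⟨hdiv, hlim⟩⟩ := h
  · have ha : 0 < a := hαa 0 ▸ hα 0
    simp only [hαa] at hs
    rcases hs with hs | hs
    · exact tendsto_zero_of_summable_const_mul_sq ha hb hs
    · exact (tendsto_add_atTop_iff_nat 1).1
        (tendsto_zero_of_summable_const_mul_sq ha (fun r => hb (r + 1)) hs)
  · have hm : ∀ r, 0 ≤ min (b r) (b (r + 1)) := fun r => le_min (hb _) (hb _)
    refine tendsto_zero_of_summable_mul_min_sq hα hb hC ?_ hdiv hlim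
    rcases hs with hs | hs
    · refine hs.of_nonneg_of_le (fun r => mul_nonneg (hα r).le (sq_nonneg _)) fun r => ?_
      exact mul_le_mul_of_nonneg_left (pow_le_pow_left₀ (hm r) (min_le_left _ _) 2) (hα r).le
    · refine hs.of_nonneg_of_le (fun r => mul_nonneg (hα r).le (sq_nonneg _)) fun r => ?_
      exact mul_le_mul_of_nonneg_left (pow_le_pow_left₀ (hm r) (min_le_right _ _) 2) (hα r).le

/-! ### The potential, and convergence of BSUM-M. -/

namespace BlockProblem

variable {K m p : ℕ} {n s : Fin K → ℕ} {P : BlockProblem K m p n s}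
  {u : (k : Fin K) → Blk n k → FullVar n → ℝ}

theorem AssumptionB.exists_uniform_strong (hB : P.AssumptionB u) : ∃ γ > 0,
    ∀ k, ∀ x ∈ P.X, ∀ v ∈ P.XBlk k, ∀ v' ∈ P.XBlk k,
      u k v' x + inner ℝ (gradient (fun z => u k z x) v') (v - v') + γ / 2 * ‖v - v'‖ ^ 2
        ≤ u k v x := by
  choose γ hγ0 hγ using hB.strong
  obtain ⟨c, hc0, hc⟩ := exists_pos_forall_le hγ0
  refine ⟨c, hc0, fun k x hx v hv v' hv' => le_trans ?_ (hγ k x hx v hv v' hv')⟩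
  have := hc k
  gcongr

/-- The norm of the gradient `q - E x̄(y)` of the dual function, as a function of `y`. -/
theorem exists_dualResidual (hA : P.AssumptionA) (hX : P.X ⊆ interior P.dom) :
    ∃ N : EuclideanSpace ℝ (Fin m) → ℝ, (∀ y, 0 ≤ N y) ∧
      (∀ y, ∀ z ∈ P.argminL y, ‖P.q - P.Emap z‖ = N y) ∧
      ∀ y y', |N y' - N y| ≤ 2 / P.rho * ‖y' - y‖ := by
  choose z hz using nonempty_argminL hA hX
  refine ⟨fun y => ‖P.q - P.Emap (z y)‖, fun y => norm_nonneg _, fun y w hw => ?_,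
    fun y y' => ?_⟩
  · have h := norm_Emap_sub_le hA hX hw (hz y)
    rw [sub_self, norm_zero, mul_zero] at h
    rw [sub_eq_zero.1 (norm_eq_zero.1 (le_antisymm h (norm_nonneg _)))]
  · refine (abs_norm_sub_norm_le _ _).trans ?_
    rw [sub_sub_sub_cancel_left, norm_sub_rev y' y]
    exact norm_Emap_sub_le hA hX (hz y) (hz y')

theorem exists_norm_sub_Emap_le (hA : P.AssumptionA) :
    ∃ R, ∀ x ∈ P.X, ‖P.q - P.Emap x‖ ≤ R :=
  (P.isCompact_X hA.compact_X).exists_bound_of_continuousOn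
    (continuous_const.sub P.continuous_Emap).continuousOn

/-- The potential function: the sum of the primal gap and the dual gap, up to a constant. -/
noncomputable def potential (P : BlockProblem K m p n s) (x : FullVar n)
    (y : EuclideanSpace ℝ (Fin m)) : ℝ := P.L x y - 2 * P.dualFun y

theorem exists_le_potential (hA : P.AssumptionA) (hX : P.X ⊆ interior P.dom) :
    ∃ B, ∀ x ∈ P.X, ∀ y, B ≤ P.potential x y := by
  obtain ⟨z, ⟨hz, hzE⟩, _⟩ := hA.primal_attained
  refine ⟨-P.f z, fun x hx y => ?_⟩
  have h1 := dualFun_le hA hX hx y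
  have h2 := dualFun_le hA hX hz y
  have h3 : P.L z y = P.f z := by simp [L, hzE]
  rw [potential]
  linarith

/-- `L` is affine in the multiplier, and the minimizer `z` for the new one is a competitor for the
old one: `d(y) ≤ L(z; y)`. -/
theorem potential_dual_step_le (hA : P.AssumptionA) (hX : P.X ⊆ interior P.dom) (x : FullVar n)
    {z : FullVar n} {y y' : EuclideanSpace ℝ (Fin m)} {a : ℝ}
    (hy : y' = y + a • (P.q - P.Emap x)) (hz : z ∈ P.argminL y') :
    P.potential x y' ≤ P.potential x y + a * ‖P.q - P.Emap x‖ ^ 2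
      - 2 * a * inner ℝ (P.q - P.Emap x) (P.q - P.Emap z) := by
  have h1 := dualFun_le hA hX hz.1 y
  have h2 := dualFun_eq hz
  have h3 : ∀ w, P.L w y' = P.L w y + a * inner ℝ (P.q - P.Emap x) (P.q - P.Emap w) := by
    intro w
    rw [L_eq, L_eq, hy, inner_add_left, inner_smul_left]
    simp only [conj_trivial]
    ring
  rw [h3 z] at h2
  rw [potential, potential, h3 x, real_inner_self_eq_norm_sq]
  linarith

/-- Completing the square separates the inexactness of `x` from the dual gradient. -/
theorem potential_dual_step_le_of_mem (hA : P.AssumptionA) (hX : P.X ⊆ interior P.dom)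
    (x : FullVar n) {z : FullVar n} {y y' : EuclideanSpace ℝ (Fin m)} {a : ℝ}
    (hy : y' = y + a • (P.q - P.Emap x)) (hz : z ∈ P.argminL y') :
    P.potential x y' ≤ P.potential x y + a * ‖P.Emap x - P.Emap z‖ ^ 2
      - a * ‖P.q - P.Emap z‖ ^ 2 := by
  have h := potential_dual_step_le hA hX x hy hz
  have e : P.Emap x - P.Emap z = (P.q - P.Emap z) - (P.q - P.Emap x) := by abel
  rw [e, norm_sub_sq_real, real_inner_comm]
  linarith

/-- The potential along a dual step, in terms of a minimizer for the old dual variable. -/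
theorem potential_dual_step_le_of_mem_old (hA : P.AssumptionA) (hX : P.X ⊆ interior P.dom)
    (x : FullVar n) {z : FullVar n} {y y' : EuclideanSpace ℝ (Fin m)} {a : ℝ} (ha : 0 ≤ a)
    (haρ : a ≤ P.rho / 16)
    (hy : y' = y + a • (P.q - P.Emap x)) (hz : z ∈ P.argminL y) :
    P.potential x y' ≤ P.potential x y + a * (3 / 2 * ‖P.Emap x - P.Emap z‖ ^ 2
      - 1 / 2 * ‖P.q - P.Emap z‖ ^ 2) := by
  obtain ⟨z', hz'⟩ := nonempty_argminL hA hX y'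
  have h := potential_dual_step_le hA hX x hy hz'
  have hρ := hA.rho_pos
  have h1 := norm_Emap_sub_le hA hX hz' hz
  rw [hy, add_sub_cancel_left, norm_smul, Real.norm_of_nonneg ha] at h1
  set e := P.q - P.Emap x with he
  set b := P.q - P.Emap z with hb
  have e1 : P.q - P.Emap z' = b - (P.Emap z' - P.Emap z) := by rw [hb]; abel
  have e2 : P.Emap x - P.Emap z = b - e := by rw [hb, he]; abel
  have h2 := (real_inner_le_norm e (P.Emap z' - P.Emap z)).trans
    (mul_le_mul_of_nonneg_left h1 (norm_nonneg e))
  -- Passing from the new minimizer to the old one costs this much; `a ≤ ρ / 16` makes it small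
  -- against the square completed below.
  have h3 : ‖e‖ * (2 / P.rho * (a * ‖e‖)) ≤ 1 / 8 * ‖e‖ ^ 2 := by
    have : 2 / P.rho * a ≤ 1 / 8 := by
      rw [div_mul_eq_mul_div, div_le_iff₀ hρ]
      linarith
    calc ‖e‖ * (2 / P.rho * (a * ‖e‖)) = 2 / P.rho * a * ‖e‖ ^ 2 := by ring
      _ ≤ _ := by gcongr
  have h4 : ‖e‖ ^ 2 ≤ 2 * ‖b‖ ^ 2 + 2 * ‖b - e‖ ^ 2 := by
    have := parallelogram_law_with_norm ℝ b (b - e)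
    rw [sub_sub_cancel] at this
    nlinarith [norm_nonneg (b + (b - e))]
  rw [e2]
  rw [e1, inner_sub_right] at h
  have h5 : ‖e‖ ^ 2 - 2 * (inner ℝ e b - inner ℝ e (P.Emap z' - P.Emap z))
      ≤ 3 / 2 * ‖b - e‖ ^ 2 - 1 / 2 * ‖b‖ ^ 2 := by
    have h6 := norm_sub_sq_real b e
    rw [real_inner_comm] at h6
    linarith
  have h7 := mul_le_mul_of_nonneg_left h5 ha
  linarith

theorem norm_Emap_sub_Emap_le (x z : FullVar n) :
    ‖P.Emap x - P.Emap z‖ ≤ (‖P.EmapL‖ + 1) * ‖x - z‖ := by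
  rw [← Emap_sub, ← EmapL_apply]
  refine (P.EmapL.le_opNorm _).trans ?_
  gcongr
  linarith

theorem exists_mem_argminL_norm_Emap_sub_le (hA : P.AssumptionA) (hX : P.X ⊆ interior P.dom)
    (x : FullVar n) (y : EuclideanSpace ℝ (Fin m)) :
    ∃ z ∈ P.argminL y,
      ‖P.Emap x - P.Emap z‖ ≤ (‖P.EmapL‖ + 1) * Metric.infDist x (P.argminL y) := by
  obtain ⟨z, hz, hd⟩ := exists_isNearest hA hX x y
  exact ⟨z, hz.1, hd ▸ norm_Emap_sub_Emap_le x z⟩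

theorem norm_sq_replaceBlock_sub {w x : FullVar n} {k : Fin K} (v : Blk n k) (h : w k = x k) :
    ‖replaceBlock w k v - x‖ ^ 2 = ‖v - w k‖ ^ 2 + ‖w - x‖ ^ 2 := by
  rw [← norm_replaceBlock_sub, ← sub_add_sub_cancel _ w x, norm_add_sq_real, real_inner_comm,
    inner_replaceBlock_sub]
  simp [h]

/-- A cycle of block updates decreases the augmented Lagrangian. -/
theorem L_cycle_le {γ : ℝ} (hA : P.AssumptionA) (hB : P.AssumptionB u)
    (hγ : ∀ k, ∀ x ∈ P.X, ∀ v ∈ P.XBlk k, ∀ v' ∈ P.XBlk k,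
      u k v' x + inner ℝ (gradient (fun z => u k z x) v') (v - v') + γ / 2 * ‖v - v'‖ ^ 2
        ≤ u k v x)
    {x x' : FullVar n} {y : EuclideanSpace ℝ (Fin m)} (hx : x ∈ P.X)
    (hx' : ∀ k, P.IsBlockArgmin u k (mixBlocks x' x k) y (x' k)) :
    P.L x' y + γ / 2 * ‖x' - x‖ ^ 2 ≤ P.L x y := by
  -- The point after `j` block updates, indexed by `ℕ` so that `w K` is the end of the cycle.
  let w : ℕ → FullVar n := fun j => WithLp.toLp 2 (fun i => if i.val < j then x' i else x i)
  have hw : ∀ j, w j ∈ P.X := by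
    intro j i
    change (if i.val < j then x' i else x i) ∈ P.XBlk i
    split_ifs
    · exact (hx' i).1
    · exact hx i
  have key : ∀ j ≤ K, P.L (w j) y + γ / 2 * ‖w j - x‖ ^ 2 ≤ P.L x y := by
    intro j
    induction j with
    | zero =>
      intro _
      have : w 0 = x := by
        ext i
        simp [w]
      simp [this]
    | succ j ih =>
      intro hj
      let k : Fin K := ⟨j, hj⟩
      have e1 : mixBlocks x' x k = w j := by
        ext i
        simp [w, mixBlocks, k, Fin.lt_def]
      have e2 : w (j + 1) = replaceBlock (w j) k (x' k) := by
        ext i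
        rcases eq_or_ne i k with rfl | hik
        · simp [w, replaceBlock, k]
        · have : i.val ≠ j := fun h => hik (Fin.ext h)
          have h2 : i.val < j + 1 ↔ i.val < j := by omega
          simp [w, replaceBlock, hik, h2]
      have e3 : w j k = x k := by simp [w, k]
      have h1 := (hx' k).L_replaceBlock_le hA hB (hγ k) (e1 ▸ hw j)
      rw [e1, ← e2] at h1
      have h2 := ih (by omega)
      -- Moves of different blocks are orthogonal, so their squared lengths add up to that of the
      -- cycle.
      rw [e2, norm_sq_replaceBlock_sub _ e3, ← e2]
      linarith
  have hK : w K = x' := by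
    ext i
    simp [w]
  simpa [hK] using key K le_rfl

theorem norm_mixBlocks_sub_le (x' x : FullVar n) (k : Fin K) :
    ‖mixBlocks x' x k - x‖ ≤ ‖x' - x‖ := by
  refine (pow_le_pow_iff_left₀ (norm_nonneg _) (norm_nonneg _) two_ne_zero).1 ?_
  rw [norm_sq_eq_sum_block, norm_sq_eq_sum_block]
  refine Finset.sum_le_sum fun j _ => ?_
  simp only [mixBlocks, PiLp.sub_apply]
  split_ifs
  · exact le_rfl
  · simp only [sub_self, norm_zero, ne_eq, OfNat.ofNat_ne_zero, not_false_eq_true, zero_pow]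
    positivity

theorem mixBlocks_mem {x' x : FullVar n} (hx' : x' ∈ P.X) (hx : x ∈ P.X) (k : Fin K) :
    mixBlocks x' x k ∈ P.X := by
  intro j
  change (if j < k then x' j else x j) ∈ P.XBlk j
  split_ifs
  · exact hx' j
  · exact hx j

theorem exists_stepsize_bsumm (hA : P.AssumptionA) (hB : P.AssumptionB u) (hEB : P.ErrorBound) :
    ∃ abar : ℝ, 0 < abar ∧ ∀ α : ℕ → ℝ, StepsizeRule abar α →
      ∀ (x : ℕ → FullVar n) (y : ℕ → EuclideanSpace ℝ (Fin m)),
        P.IsBSUMM u α x y → P.Converges x y := by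
  have hX := hB.X_subset
  obtain ⟨γ, hγ0, hγ⟩ := hB.exists_uniform_strong
  obtain ⟨C, hC0, hC⟩ := exists_infDist_argminL_le hA hB hEB
  obtain ⟨N, hN0, hN, hNlip⟩ := exists_dualResidual hA hX
  obtain ⟨R, hR⟩ := exists_norm_sub_Emap_le hA
  obtain ⟨B, hBd⟩ := exists_le_potential hA hX
  set c := ((‖P.EmapL‖ + 1) * C) ^ 2 with hc
  have hc0 : 0 < c := by positivity
  -- With this bound the dual error takes up at most half of the descent `γ / 2`.
  refine ⟨γ / (4 * c), by positivity, fun α hα x y hxy => ?_⟩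
  obtain ⟨T, hT⟩ := hα.exists_forall_lt (by positivity)
  have hx : ∀ r, x r ∈ P.X := fun r => by
    cases r with
    | zero => exact hxy.1
    | succ r => exact fun k => ((hxy.2 r).2 k).1
  have hdist : ∀ r, Metric.infDist (x r) (P.argminL (y (r + 1))) ≤ C * ‖x (r + 1) - x r‖ := by
    intro r
    refine hC _ _ (hx r) _ fun k => ⟨_, mixBlocks_mem (hx (r + 1)) (hx r) k, ?_,
      norm_mixBlocks_sub_le _ _ _, (hxy.2 r).2 k⟩
    simp [mixBlocks]
  -- Diminishing steps may start large; the finitely many iterations before `T` do not affect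
  -- summability.
  have hdec : ∀ r, T ≤ r → P.potential (x (r + 1)) (y (r + 1)) ≤ P.potential (x r) (y r)
      - (γ / 4 * ‖x (r + 1) - x r‖ ^ 2 + α r * N (y (r + 1)) ^ 2) := by
    intro r hr
    obtain ⟨z, hz, hzd⟩ := exists_mem_argminL_norm_Emap_sub_le hA hX (x r) (y (r + 1))
    have h1 := potential_dual_step_le_of_mem hA hX (x r) (hxy.2 r).1 hz
    have h2 := L_cycle_le hA hB hγ (hx r) (hxy.2 r).2
    have h3 : ‖P.Emap (x r) - P.Emap z‖ ^ 2 ≤ c * ‖x (r + 1) - x r‖ ^ 2 := by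
      rw [hc, ← mul_pow, mul_assoc]
      have := hdist r
      gcongr
      exact hzd.trans (by gcongr)
    have h4 : α r * (c * ‖x (r + 1) - x r‖ ^ 2) ≤ γ / 4 * ‖x (r + 1) - x r‖ ^ 2 := by
      rw [← mul_assoc]
      have h5 := hT r hr
      rw [lt_div_iff₀ (by positivity)] at h5
      gcongr
      linarith
    have h6 := mul_le_mul_of_nonneg_left h3 (hα.1 r).le
    rw [hN _ z hz] at h1
    simp only [potential] at h1 ⊢
    linarith
  have hsum : Summable (fun r => γ / 4 * ‖x (r + 1) - x r‖ ^ 2 + α r * N (y (r + 1)) ^ 2) := by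
    refine (summable_nat_add_iff T).1 ?_
    refine summable_of_le_sub (V := fun r => P.potential (x (r + T)) (y (r + T))) (B := B)
      (fun r => ?_) (fun r => hBd _ (hx _) _) (fun r => ?_)
    · have := hα.1 (r + T)
      positivity
    · simp only [add_right_comm r 1 T]
      exact hdec (r + T) (by omega)
  have hsx : Summable (fun r => γ / 4 * ‖x (r + 1) - x r‖ ^ 2) := by
    refine hsum.of_nonneg_of_le (fun r => by positivity) fun r => ?_
    have := hα.1 r
    have : 0 ≤ α r * N (y (r + 1)) ^ 2 := by positivity
    linarith
  have hsN : Summable (fun r => α r * N (y (r + 1)) ^ 2) := by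
    refine hsum.of_nonneg_of_le (fun r => ?_) fun r => ?_
    · have := hα.1 r
      positivity
    · have : 0 ≤ γ / 4 * ‖x (r + 1) - x r‖ ^ 2 := by positivity
      linarith
  have hstep : Tendsto (fun r => ‖x (r + 1) - x r‖) atTop (𝓝 0) :=
    tendsto_zero_of_summable_const_mul_sq (by positivity) (fun r => norm_nonneg _) hsx
  refine converges_of_tendsto hA hX hx (by simpa only [norm_sub_rev] using hstep) ?_ ?_
  -- `hdist` pairs `x r` with `y (r + 1)`; replacing `x r` by `x (r + 1)` costs one more move.
  · refine (tendsto_add_atTop_iff_nat 1).1 ?_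
    refine squeeze_zero (fun _ => Metric.infDist_nonneg) (fun r => ?_)
      (by simpa using hstep.const_mul (C + 1))
    have h1 := Metric.infDist_le_infDist_add_dist (s := P.argminL (y (r + 1))) (x := x (r + 1))
      (y := x r)
    rw [dist_eq_norm] at h1
    linarith [hdist r]
  · intro z hz
    simp only [fun r => hN _ _ (hz r)]
    refine hα.tendsto_zero (C := 2 / P.rho * R) (fun r => hN0 _) (fun r => ?_) (Or.inr hsN)
    refine (hNlip _ _).trans ?_
    have hρ := hA.rho_pos
    rw [(hxy.2 r).1, add_sub_cancel_left, norm_smul, Real.norm_of_nonneg (hα.1 r).le, mul_assoc,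
      mul_comm (α r)]
    have := hR _ (hx r)
    have := hα.1 r
    gcongr

end BlockProblem

/-! ### Functions of finitely many independent draws, and descent in expectation. -/

section Past

variable {Ω ι β : Type*}

/-- `f` is a function of the first `t` terms of the sequence `idx`. -/
def DependsOnPast (idx : ℕ → Ω → ι) (t : ℕ) (f : Ω → β) : Prop :=
  ∀ ω ω', (∀ s < t, idx s ω = idx s ω') → f ω = f ω'

variable {idx : ℕ → Ω → ι} {t : ℕ}

theorem DependsOnPast.exists_eq_comp [Nonempty β] {f : Ω → β} (h : DependsOnPast idx t f) :
    ∃ F : (Finset.range t → ι) → β, f = F ∘ fun ω (s : Finset.range t) => idx s ω := by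
  refine (Function.factorsThrough_iff f).1 fun ω ω' hωω' => h ω ω' fun s hs => ?_
  exact congr_fun hωω' ⟨s, Finset.mem_range.2 hs⟩

theorem DependsOnPast.comp {β' : Type*} {f : Ω → β} (h : DependsOnPast idx t f) (g : β → β') :
    DependsOnPast idx t (fun ω => g (f ω)) := fun ω ω' hωω' => congr_arg g (h ω ω' hωω')

variable [MeasurableSpace Ω] {μ : Measure Ω} [IsProbabilityMeasure μ]
  [MeasurableSpace ι] [MeasurableSingletonClass ι]

/-- `f` factors through a finite set, so it is measurable and bounded automatically; the iterates
need no measurability assumption. -/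
theorem DependsOnPast.integrable [Finite ι] {f : Ω → ℝ} (hidx : ∀ t, Measurable (idx t))
    (h : DependsOnPast idx t f) : Integrable f μ := by
  obtain ⟨F, rfl⟩ := h.exists_eq_comp
  have hm : Measurable (fun ω (s : Finset.range t) => idx s ω) :=
    measurable_pi_lambda _ fun s => hidx s
  have := Measure.isProbabilityMeasure_map (μ := μ) hm.aemeasurable
  exact Integrable.comp_measurable Integrable.of_finite hm

theorem integrable_indicator_mul [Finite ι] {f : Ω → ℝ} (hidx : ∀ t, Measurable (idx t))
    (h : DependsOnPast idx t f) (i : ι) :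
    Integrable (fun ω => (idx t ⁻¹' {i}).indicator 1 ω * f ω) μ := by
  have h1 : (fun ω => (idx t ⁻¹' {i}).indicator 1 ω * f ω) = (idx t ⁻¹' {i}).indicator f := by
    ext ω
    by_cases hω : ω ∈ idx t ⁻¹' {i} <;> simp [hω]
  rw [h1]
  exact (h.integrable hidx).indicator (hidx t (measurableSet_singleton i))

/-- A function of the past is independent of the present index. -/
theorem integral_indicator_mul [Finite ι] {f : Ω → ℝ} (hidx : ∀ t, Measurable (idx t))
    (hind : iIndepFun idx μ) (h : DependsOnPast idx t f) (i : ι) :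
    ∫ ω, (idx t ⁻¹' {i}).indicator 1 ω * f ω ∂μ = μ.real (idx t ⁻¹' {i}) * ∫ ω, f ω ∂μ := by
  obtain ⟨F, rfl⟩ := h.exists_eq_comp
  have hdisj : Disjoint {t} (Finset.range t) := by simp
  have h1 := hind.indepFun_finset {t} (Finset.range t) hdisj hidx
  have h2 := h1.comp (φ := fun g => ({i} : Set ι).indicator (1 : ι → ℝ) (g ⟨t, by simp⟩)) (ψ := F)
    (measurable_of_finite _) (measurable_of_finite F)
  have e : ((fun g : ({t} : Finset ℕ) → ι => ({i} : Set ι).indicator (1 : ι → ℝ) (g ⟨t, by simp⟩)) ∘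
      fun ω (s : ({t} : Finset ℕ)) => idx s ω) = (idx t ⁻¹' {i}).indicator 1 := by
    ext ω
    by_cases hω : idx t ω = i <;> simp [hω]
  rw [e] at h2
  have hm : MeasurableSet (idx t ⁻¹' {i}) := hidx t (measurableSet_singleton i)
  rw [h2.integral_fun_mul_eq_mul_integral (measurable_one.indicator hm).aestronglyMeasurable
    (h.integrable hidx).aestronglyMeasurable, integral_indicator_one hm]

/-- If a potential that is bounded below and depends on the past only decreases in conditional
expectation by at least `D`, then `D` is almost surely summable. -/
theorem ae_summable_of_sum_mul_le [Fintype ι] {prob : ι → ℝ} {V D : ℕ → Ω → ℝ}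
    {W : ℕ → ι → Ω → ℝ} {B : ℝ} {T : ℕ} (hidx : ∀ t, Measurable (idx t)) (hind : iIndepFun idx μ)
    (hprob : ∀ t i, μ.real (idx t ⁻¹' {i}) = prob i)
    (hV : ∀ t, DependsOnPast idx t (V t)) (hD : ∀ t, DependsOnPast idx t (D t))
    (hW : ∀ t i, DependsOnPast idx t (W t i)) (hD0 : ∀ t ω, 0 ≤ D t ω) (hVB : ∀ t ω, B ≤ V t ω)
    (hstep : ∀ t ω, V (t + 1) ω ≤ V t ω + W t (idx t ω) ω)
    (hdec : ∀ t, T ≤ t → ∀ ω, ∑ i, prob i * W t i ω ≤ -D t ω) :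
    ∀ᵐ ω ∂μ, Summable (fun t => D t ω) := by
  have hsum : Summable (fun t => ∫ ω, D t ω ∂μ) := by
    refine (summable_nat_add_iff T).1 (summable_of_le_sub (V := fun t => ∫ ω, V (t + T) ω ∂μ)
      (B := B) (fun t => integral_nonneg (hD0 _)) (fun t => ?_) (fun t => ?_))
    · have := integral_mono (μ := μ) (integrable_const B) ((hV (t + T)).integrable hidx)
        (hVB (t + T))
      simpa using this
    · set r := t + T with hr
      have hint : ∀ i ∈ Finset.univ, Integrable
          (fun ω => (idx r ⁻¹' {i}).indicator 1 ω * W r i ω) μ :=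
        fun i _ => integrable_indicator_mul hidx (hW r i) i
      have hWi : ∀ i, Integrable (W r i) μ := fun i => (hW r i).integrable hidx
      -- The increment is split over the values of the present draw, each indicator being
      -- independent of `W r i`; this takes the place of conditional expectations.
      have h1 : ∫ ω, V (r + 1) ω ∂μ ≤
          ∫ ω, (V r ω + ∑ i, (idx r ⁻¹' {i}).indicator 1 ω * W r i ω) ∂μ := by
        refine integral_mono ((hV _).integrable hidx) (((hV r).integrable hidx).add
          (integrable_finsetSum _ hint)) fun ω => ?_
        refine (hstep r ω).trans (le_of_eq ?_)
        congr 1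
        rw [Finset.sum_eq_single (idx r ω)]
        · simp
        · intro i _ hi
          simp [Set.indicator, hi.symm]
        · simp
      have h2 : ∫ ω, (V r ω + ∑ i, (idx r ⁻¹' {i}).indicator 1 ω * W r i ω) ∂μ
          = ∫ ω, V r ω ∂μ + ∫ ω, ∑ i, prob i * W r i ω ∂μ := by
        rw [integral_add ((hV r).integrable hidx) (integrable_finsetSum _ hint),
          integral_finsetSum _ hint, integral_finsetSum _ fun i _ => (hWi i).const_mul _]
        simp only [integral_indicator_mul hidx hind (hW r _), hprob, integral_const_mul]
      have h3 : ∫ ω, ∑ i, prob i * W r i ω ∂μ ≤ ∫ ω, -D r ω ∂μ :=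
        integral_mono (integrable_finsetSum _ fun i _ => (hWi i).const_mul _)
          ((hD r).integrable hidx).neg (hdec r (by omega))
      rw [integral_neg] at h3
      have e : t + 1 + T = r + 1 := by omega
      simp only [e]
      linarith
  have hDi : ∀ t, Integrable (D t) μ := fun t => (hD t).integrable hidx
  -- By Tonelli the series has finite expectation, hence is almost surely finite.
  have hlin : ∫⁻ ω, ∑' t, ENNReal.ofReal (D t ω) ∂μ ≠ ⊤ := by
    rw [lintegral_tsum fun t => (hDi t).aestronglyMeasurable.aemeasurable.ennreal_ofReal]
    have e : ∀ t, ∫⁻ ω, ENNReal.ofReal (D t ω) ∂μ = ENNReal.ofReal (∫ ω, D t ω ∂μ) := fun t =>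
      (ofReal_integral_eq_lintegral_ofReal (hDi t) (ae_of_all _ (hD0 t))).symm
    simp only [e]
    exact hsum.tsum_ofReal_ne_top
  have hmeas : AEMeasurable (fun ω => ∑' t, ENNReal.ofReal (D t ω)) μ :=
    AEMeasurable.tsum fun t => (hDi t).aestronglyMeasurable.aemeasurable.ennreal_ofReal
  filter_upwards [ae_lt_top' hmeas hlin] with ω hω
  refine (ENNReal.summable_toReal hω.ne).congr fun t => ?_
  exact ENNReal.toReal_ofReal (hD0 t ω)

end Past

/-! ### Convergence of RBSUM-M. -/

namespace BlockProblem

variable {K m p : ℕ} {n s : Fin K → ℕ} {P : BlockProblem K m p n s}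
  {u : (k : Fin K) → Blk n k → FullVar n → ℝ}

/-- `G` updates all blocks at once from the same point. The random algorithm realizes one block of
this move at a time, and each block with a fixed positive probability. -/
theorem exists_blockArgmin_map (hA : P.AssumptionA) (hB : P.AssumptionB u) :
    ∃ G : FullVar n × EuclideanSpace ℝ (Fin m) → FullVar n,
      ∀ z, z.1 ∈ P.X → ∀ k, P.IsBlockArgmin u k z.1 z.2 (G z k) := by
  classical
  have h : ∀ (z : FullVar n × EuclideanSpace ℝ (Fin m)) (k : Fin K), ∃ v : Blk n k,
      z.1 ∈ P.X → P.IsBlockArgmin u k z.1 z.2 v := by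
    intro z k
    by_cases hz : z.1 ∈ P.X
    · obtain ⟨v, hv⟩ := exists_isBlockArgmin hA hB k hz z.2
      exact ⟨v, fun _ => hv⟩
    · exact ⟨0, fun hh => absurd hh hz⟩
  choose v hv using h
  exact ⟨fun z => WithLp.toLp 2 (v z), fun z hz k => hv z k hz⟩

variable {α : ℕ → ℝ} {i : ℕ → Fin (K + 1)} {x : ℕ → FullVar n}
  {y : ℕ → EuclideanSpace ℝ (Fin m)}

theorem IsRBSUMM.eq_replaceBlock (h : P.IsRBSUMM u α i x y) {t : ℕ} {k : Fin K}
    (hk : i t = k.succ) : x (t + 1) = replaceBlock (x t) k (x (t + 1) k) := by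
  ext j l
  rcases eq_or_ne j k with rfl | hj
  · rw [replaceBlock_apply_self]
  · rw [replaceBlock_apply_of_ne _ hj, ((h.2 t).2 k hk).2.1 j hj]

theorem IsRBSUMM.mem_X (h : P.IsRBSUMM u α i x y) (t : ℕ) : x t ∈ P.X := by
  induction t with
  | zero => exact h.1
  | succ t ih =>
    rcases Fin.eq_zero_or_eq_succ (i t) with h0 | ⟨k, hk⟩
    · rw [((h.2 t).1 h0).2]
      exact ih
    · rw [h.eq_replaceBlock hk]
      exact replaceBlock_mem ih ((h.2 t).2 k hk).1.1

/-- The iterates of RBSUM-M are determined by the starting point and the indices drawn so far. -/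
theorem IsRBSUMM.eq_of_forall_eq (hA : P.AssumptionA) (hB : P.AssumptionB u)
    {i' : ℕ → Fin (K + 1)} {x' : ℕ → FullVar n} {y' : ℕ → EuclideanSpace ℝ (Fin m)}
    (h : P.IsRBSUMM u α i x y) (h' : P.IsRBSUMM u α i' x' y') (hx0 : x 0 = x' 0)
    (hy0 : y 0 = y' 0) (t : ℕ) (hi : ∀ s < t, i s = i' s) : (x t, y t) = (x' t, y' t) := by
  induction t with
  | zero => rw [hx0, hy0]
  | succ t ih =>
    obtain ⟨hx, hy⟩ := Prod.mk.inj (ih fun s hs => hi s (by omega))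
    have hit := hi t (by omega)
    rcases Fin.eq_zero_or_eq_succ (i t) with h0 | ⟨k, hk⟩
    · obtain ⟨a1, a2⟩ := (h.2 t).1 h0
      obtain ⟨b1, b2⟩ := (h'.2 t).1 (hit ▸ h0)
      rw [a1, a2, b1, b2, hx, hy]
    · have hk' : i' t = k.succ := hit ▸ hk
      obtain ⟨a1, -, a3⟩ := (h.2 t).2 k hk
      obtain ⟨b1, -, b3⟩ := (h'.2 t).2 k hk'
      have e : x (t + 1) k = x' (t + 1) k :=
        a1.eq hA hB (h.mem_X t) (by rw [hx, hy]; exact b1)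
      rw [h.eq_replaceBlock hk, h'.eq_replaceBlock hk', a3, b3, hx, hy, e]

theorem exists_stepsize_rbsumm (hA : P.AssumptionA) (hB : P.AssumptionB u) (hEB : P.ErrorBound)
    (prob : Fin (K + 1) → ℝ) (hprob : ∀ i, 0 < prob i) (hprob1 : ∑ i, prob i = 1) :
    ∃ abar : ℝ, 0 < abar ∧ ∀ α : ℕ → ℝ, StepsizeRule abar α →
      ∀ (Ω : Type*) [MeasurableSpace Ω] (μ : Measure Ω) [IsProbabilityMeasure μ]
        (idx : ℕ → Ω → Fin (K + 1)),
        (∀ t, Measurable (idx t)) → iIndepFun idx μ →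
        (∀ t i, μ {ω | idx t ω = i} = ENNReal.ofReal (prob i)) →
      ∀ (x₀ : FullVar n) (y₀ : EuclideanSpace ℝ (Fin m))
        (x : ℕ → Ω → FullVar n) (y : ℕ → Ω → EuclideanSpace ℝ (Fin m)),
        (∀ ω, x 0 ω = x₀ ∧ y 0 ω = y₀) →
        (∀ ω, P.IsRBSUMM u α (fun t => idx t ω) (fun t => x t ω) (fun t => y t ω)) →
        ∀ᵐ ω ∂μ, P.Converges (fun t => x t ω) (fun t => y t ω) := by
  have hX := hB.X_subset
  have hρ := hA.rho_pos
  obtain ⟨γ, hγ0, hγ⟩ := hB.exists_uniform_strong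
  obtain ⟨C, hC0, hC⟩ := exists_infDist_argminL_le hA hB hEB
  obtain ⟨N, hN0, hN, hNlip⟩ := exists_dualResidual hA hX
  obtain ⟨R, hR⟩ := exists_norm_sub_Emap_le hA
  obtain ⟨B, hBd⟩ := exists_le_potential hA hX
  obtain ⟨G, hG⟩ := exists_blockArgmin_map hA hB
  obtain ⟨π, hπ0, hπ⟩ := exists_pos_forall_le hprob
  have hp0 : prob 0 ≤ 1 := hprob1 ▸
    Finset.single_le_sum (fun i _ => (hprob i).le) (Finset.mem_univ 0)
  set c := ((‖P.EmapL‖ + 1) * C) ^ 2 with hc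
  have hc0 : 0 < c := by positivity
  -- The first bound permits the dual estimate at the old multiplier. The second lets the error `3/2
  -- * α * c` take up at most half of the expected block descent `π * γ / 2`.
  refine ⟨min (P.rho / 16) (π * γ / (6 * c)), by positivity, ?_⟩
  intro α hα Ω _ μ _ idx hidx hind hlaw x₀ y₀ x y h0 hxy
  have hα0 := hα.1
  obtain ⟨T, hT⟩ := hα.exists_forall_lt (by positivity)
  have hx : ∀ t ω, x t ω ∈ P.X := fun t ω => (hxy ω).mem_X t
  have hdist : ∀ t ω, Metric.infDist (x t ω) (P.argminL (y t ω))
      ≤ C * ‖G (x t ω, y t ω) - x t ω‖ := fun t ω =>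
    hC _ _ (hx t ω) _ fun k => ⟨x t ω, hx t ω, rfl, by simp, hG (x t ω, y t ω) (hx t ω) k⟩
  have hpast : ∀ t, DependsOnPast idx t (fun ω => (x t ω, y t ω)) := fun t ω ω' hωω' =>
    (hxy ω).eq_of_forall_eq hA hB (hxy ω') ((h0 ω).1.trans (h0 ω').1.symm)
      ((h0 ω).2.trans (h0 ω').2.symm) t hωω'
  have hdual : ∀ t ω, idx t ω = 0 →
      y (t + 1) ω = y t ω + α t • (P.q - P.Emap (x t ω)) ∧ x (t + 1) ω = x t ω :=
    fun t ω => ((hxy ω).2 t).1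
  have hblk : ∀ t ω (k : Fin K), idx t ω = k.succ →
      x (t + 1) ω = replaceBlock (x t ω) k (G (x t ω, y t ω) k) ∧ y (t + 1) ω = y t ω := by
    intro t ω k hk
    have h1 := (hxy ω).eq_replaceBlock hk
    rw [(((hxy ω).2 t).2 k hk).1.eq hA hB (hx t ω) (hG (x t ω, y t ω) (hx t ω) k)] at h1
    exact ⟨h1, (((hxy ω).2 t).2 k hk).2.2⟩
  -- Bounds on the increment of the potential for each draw. Before `T` the dual estimate may fail,
  -- and the exact increment is used.
  let Wf : ℕ → Fin (K + 1) → FullVar n × EuclideanSpace ℝ (Fin m) → ℝ := fun t i z =>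
    Fin.cases (if T ≤ t then α t * (3 / 2 * (c * ‖G z - z.1‖ ^ 2) - 1 / 2 * N z.2 ^ 2)
      else P.potential z.1 (z.2 + α t • (P.q - P.Emap z.1)) - P.potential z.1 z.2)
      (fun k => -(γ / 2 * ‖G z k - z.1 k‖ ^ 2)) i
  let Df : ℕ → FullVar n × EuclideanSpace ℝ (Fin m) → ℝ := fun t z =>
    π * γ / 4 * ‖G z - z.1‖ ^ 2 + prob 0 / 2 * (α t * N z.2 ^ 2)
  have hDf : ∀ t z, 0 ≤ Df t z := fun t z => by
    have := hα0 t
    have := hprob 0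
    positivity
  have hsum : ∀ᵐ ω ∂μ, Summable (fun t => Df t (x t ω, y t ω)) := by
    refine ae_summable_of_sum_mul_le (prob := prob)
      (V := fun t ω => P.potential (x t ω) (y t ω))
      (W := fun t i ω => Wf t i (x t ω, y t ω)) (T := T) (B := B) hidx hind ?_
      (fun t => (hpast t).comp fun z => P.potential z.1 z.2) (fun t => (hpast t).comp (Df t))
      (fun t i => (hpast t).comp (Wf t i)) (fun t ω => hDf t _)
      (fun t ω => hBd _ (hx t ω) _) ?_ ?_
    · intro t i
      rw [measureReal_def]
      have := hlaw t i
      rw [show idx t ⁻¹' {i} = {ω | idx t ω = i} from rfl, this,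
        ENNReal.toReal_ofReal (hprob i).le]
    · intro t ω
      rcases Fin.eq_zero_or_eq_succ (idx t ω) with hi | ⟨k, hk⟩
      · obtain ⟨h1, h2⟩ := hdual t ω hi
        simp only [Wf, hi, Fin.cases_zero]
        split_ifs with hTt
        · obtain ⟨z, hz, hzd⟩ := exists_mem_argminL_norm_Emap_sub_le hA hX (x t ω) (y t ω)
          have hαt := hT t hTt
          have h3 := potential_dual_step_le_of_mem_old hA hX (x t ω) (hα0 t).le
            (hαt.le.trans (min_le_left _ _)) h1 hz
          rw [hN _ z hz] at h3
          rw [h2]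
          refine h3.trans ?_
          have h4 : ‖P.Emap (x t ω) - P.Emap z‖ ^ 2 ≤ c * ‖G (x t ω, y t ω) - x t ω‖ ^ 2 := by
            rw [hc, ← mul_pow, mul_assoc]
            have := hdist t ω
            gcongr
            exact hzd.trans (by gcongr)
          have := hα0 t
          gcongr
        · rw [h1, h2]
          linarith
      · simp only [Wf, hk, Fin.cases_succ]
        rw [(hblk t ω k hk).1, (hblk t ω k hk).2]
        have := (hG (x t ω, y t ω) (hx t ω) k).L_replaceBlock_le hA hB (hγ k) (hx t ω)
        simp only [potential]
        linarith
    · intro t hTt ω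
      simp only [Wf, Df, Fin.sum_univ_succ, Fin.cases_zero, Fin.cases_succ, if_pos hTt]
      set z : FullVar n × EuclideanSpace ℝ (Fin m) := (x t ω, y t ω)
      have hαt := (hT t hTt).le.trans (min_le_right _ _)
      rw [le_div_iff₀ (by positivity)] at hαt
      have h1 : ∑ k : Fin K, prob k.succ * -(γ / 2 * ‖G z k - z.1 k‖ ^ 2)
          ≤ -(π * γ / 2 * ‖G z - z.1‖ ^ 2) := by
        rw [norm_sq_eq_sum_block, Finset.mul_sum, ← Finset.sum_neg_distrib]
        refine Finset.sum_le_sum fun k _ => ?_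
        rw [mul_neg, neg_le_neg_iff, PiLp.sub_apply, ← mul_assoc, mul_div_assoc]
        have := hπ k.succ
        gcongr
      have h2 : prob 0 * (α t * (3 / 2 * (c * ‖G z - z.1‖ ^ 2)))
          ≤ π * γ / 4 * ‖G z - z.1‖ ^ 2 := by
        have h3 : 0 ≤ α t * (3 / 2 * (c * ‖G z - z.1‖ ^ 2)) := by
          have := hα0 t
          positivity
        calc prob 0 * (α t * (3 / 2 * (c * ‖G z - z.1‖ ^ 2)))
            ≤ 1 * (α t * (3 / 2 * (c * ‖G z - z.1‖ ^ 2))) := by gcongr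
          _ = α t * (6 * c) / 4 * ‖G z - z.1‖ ^ 2 := by ring
          _ ≤ _ := by gcongr
      linarith
  filter_upwards [hsum] with ω hω
  have hsx : Summable (fun t => π * γ / 4 * ‖G (x t ω, y t ω) - x t ω‖ ^ 2) := by
    refine hω.of_nonneg_of_le (fun t => by positivity) fun t => ?_
    have := hα0 t
    have := hprob 0
    have : 0 ≤ prob 0 / 2 * (α t * N (y t ω) ^ 2) := by positivity
    simp only [Df]
    linarith
  have hsN : Summable (fun t => α t * N (y t ω) ^ 2) := by
    have hp : prob 0 / 2 ≠ 0 := by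
      have := hprob 0
      positivity
    refine (summable_mul_left_iff hp).1 (hω.of_nonneg_of_le (fun t => ?_) fun t => ?_)
    · have := hα0 t
      have := hprob 0
      positivity
    · have : 0 ≤ π * γ / 4 * ‖G (x t ω, y t ω) - x t ω‖ ^ 2 := by positivity
      simp only [Df]
      linarith
  have hstep : Tendsto (fun t => ‖G (x t ω, y t ω) - x t ω‖) atTop (𝓝 0) :=
    tendsto_zero_of_summable_const_mul_sq (by positivity) (fun t => norm_nonneg _) hsx
  refine converges_of_tendsto hA hX (fun t => hx t ω) ?_ ?_ ?_
  -- The actual move is zero or a single block of the hypothetical one.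
  · refine squeeze_zero (fun _ => norm_nonneg _) (fun t => ?_) hstep
    rcases Fin.eq_zero_or_eq_succ (idx t ω) with hi | ⟨k, hk⟩
    · rw [(hdual t ω hi).2, sub_self, norm_zero]
      exact norm_nonneg _
    · rw [(hblk t ω k hk).1, norm_sub_rev, norm_replaceBlock_sub]
      exact norm_block_le (G (x t ω, y t ω) - x t ω) k
  · exact squeeze_zero (fun _ => Metric.infDist_nonneg) (fun t => hdist t ω)
      (by simpa using hstep.const_mul C)
  · intro z hz
    simp only [fun t => hN _ _ (hz t)]
    refine hα.tendsto_zero (C := 2 / P.rho * R) (fun t => hN0 _) (fun t => ?_) (Or.inl hsN)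
    refine (hNlip _ _).trans ?_
    have h1 := hR _ (hx t ω)
    have h2 := hα0 t
    have hR0 : 0 ≤ R := (norm_nonneg _).trans h1
    -- The residual changes by `O(α t)` at a dual draw and not at all at a block draw.
    rcases Fin.eq_zero_or_eq_succ (idx t ω) with hi | ⟨k, hk⟩
    · rw [(hdual t ω hi).1, add_sub_cancel_left, norm_smul, Real.norm_of_nonneg h2.le,
        mul_assoc, mul_comm (α t)]
      gcongr
    · rw [(hblk t ω k hk).2, sub_self, norm_zero, mul_zero]
      positivity

end BlockProblem

theorem theorem2p1 {K m p : ℕ} {n s : Fin K → ℕ} (P : BlockProblem K m p n s)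
    (u : (k : Fin K) → Blk n k → FullVar n → ℝ)
    (hA : P.AssumptionA) (hB : P.AssumptionB u) (hEB : P.ErrorBound) :
    (∃ abar : ℝ, 0 < abar ∧ ∀ α : ℕ → ℝ, StepsizeRule abar α →
      ∀ (x : ℕ → FullVar n) (y : ℕ → EuclideanSpace ℝ (Fin m)),
        P.IsBSUMM u α x y → P.Converges x y) ∧
    (∀ prob : Fin (K + 1) → ℝ, (∀ i, 0 < prob i) → ∑ i, prob i = 1 →
      ∃ abar : ℝ, 0 < abar ∧ ∀ α : ℕ → ℝ, StepsizeRule abar α →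
      ∀ (Ω : Type*) [MeasurableSpace Ω] (μ : Measure Ω) [IsProbabilityMeasure μ]
        (idx : ℕ → Ω → Fin (K + 1)),
        (∀ t, Measurable (idx t)) → iIndepFun idx μ →
        (∀ t i, μ {ω | idx t ω = i} = ENNReal.ofReal (prob i)) →
      ∀ (x₀ : FullVar n) (y₀ : EuclideanSpace ℝ (Fin m))
        (x : ℕ → Ω → FullVar n) (y : ℕ → Ω → EuclideanSpace ℝ (Fin m)),
        (∀ ω, x 0 ω = x₀ ∧ y 0 ω = y₀) →
        (∀ ω, P.IsRBSUMM u α (fun t => idx t ω) (fun t => x t ω) (fun t => y t ω)) →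
        ∀ᵐ ω ∂μ, P.Converges (fun t => x t ω) (fun t => y t ω)) := by
  exact ⟨BlockProblem.exists_stepsize_bsumm hA hB hEB,
    BlockProblem.exists_stepsize_rbsumm hA hB hEB⟩
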